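/- Define $b(1)=0$, $b(2)=1$, $b(3)=b(4)=b(5)=b(7)=3$, and $b(q)=2$ for every other prime power $q$. For a prime $p$ and $r\ge 1$, say that $p^r$ exactly divides $n$, written $p^r\parallel n$, if $p^r\mid n$ and $p^{r+1}\nmid n$. Let $n\ge 1$ be an integer and write $n=p_1^{r_1}p_2^{r_2}\cdots p_k^{r_k}$, where $k\ge 0$, the $p_i$ are distinct primes and $r_i\ge 1$ for every $i$. Let $\beta(\mathbb{Z}_n)$ be the minimum number of points of a finite poset (possibly empty) whose automorphism group is isomorphic to the cyclic group $\mathbb{Z}_n$ of order $n$. Then this minimum exists, and $$\beta(\mathbb{Z}_n)=\begin{cases}\displaystyle\sum_{i=1}^k b(p_i^{r_i})\,p_i^{r_i}-1 & \text{if } 3\parallel n \text{ and } 4\parallel n,\\[2ex] \displaystyle\sum_{i=1}^k b(p_i^{r_i})\,p_i^{r_i} & \text{otherwise.}\end{cases}$$ -/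

import Mathlib

universe u v

namespace CyclicPoset

/-- The set of all `m` such that some finite poset with exactly `m` points has automorphism
group isomorphic to `G`. -/
def posetSizes (G : Type v) [Group G] : Set ℕ :=
  {m | ∃ (P : Type u) (_ : PartialOrder P) (_ : Finite P),
    Nat.card P = m ∧ Nonempty ((P ≃o P) ≃* G)}

/-- The prime power `p ^ r` exactly divides `n`. -/
def ExactlyDivides (p r n : ℕ) : Prop :=
  p ^ r ∣ n ∧ ¬ p ^ (r + 1) ∣ n

/-- `b 1 = 0`, `b 2 = 1`, `b 3 = b 4 = b 5 = b 7 = 3`, and `b q = 2` for every other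
prime power `q` (the values at numbers that are not prime powers are irrelevant). -/
def b (q : ℕ) : ℕ :=
  if q = 1 then 0
  else if q = 2 then 1
  else if q = 3 ∨ q = 4 ∨ q = 5 ∨ q = 7 then 3
  else 2

/-- The sum of `b (p ^ r) * p ^ r` over the prime powers `p ^ r`, `r ≥ 1`, in the prime
factorization of `n`. -/
def weightedSum (n : ℕ) : ℕ :=
  ∑ p ∈ n.primeFactors, b (p ^ n.factorization p) * p ^ n.factorization p

end CyclicPoset

/-! Upper bound. In an ordinal sum of finite posets every automorphism preserves both summands
(`add_mem_posetSizes`), so coprime cyclic groups multiply while point counts add, and prime powers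
`q` suffice. Two points serve for 2, three levels of `q` points serve for any `q ≥ 2`, and two
levels serve when `ZMod q` has a rigid enough subset, as it does for 8, 9 and all `q ≥ 11`. For 12 a
poset with orbits of lengths 4, 4, 6, 6 has 20 points, one fewer than 12 + 9.

Lower bound. Let `g` generate the automorphism group and let `q ≠ 2` be an exact prime power of its
order. Were there only one orbit of length divisible by `q`, exchanging two of its points would be
an automorphism not commuting with `g` (`exists_other_orbit`), so there are at least two. If two of
them have lengths with gcd exactly `q`, the order between them is given by a subset `S` of `ZMod q`,
and a symmetry of `S` other than a rotation lifts to a forbidden automorphism as long as no other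
point feels it (`twist_add_one`). For `q` = 3, 5, 7 every `S` has such a symmetry, which forces a
third orbit. For `q` = 4 the points of other even orbits may obstruct the lift, which leaves the
alternative of two further even orbits.

The rest is counting (`OrbitLengths.weightedSum_le`). An orbit is charged `2q` or `3q` for each such
`q` dividing its length, the larger charge applying when just two orbits have length divisible by
`q` and their lengths share a further factor. Since products of coprime numbers outgrow sums, no
orbit is charged more than twice its length, while the total charge for `q` is normally at least `2
* b q * q`. The exceptions `q` = 2 and `q` = 4 are paid for by orbits of length 2 modulo 4, each of
which leaves at least 4 uncharged, or only 3 if its length is 6 and 3 exactly divides `n`. Two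
orbits of the latter kind leave 6 instead of the 8 that `q` = 4 may need: this is the one point
saved. -/

namespace CyclicPoset

/-! ### Posets from strict orders, and ordinal sums -/

/-- If every permutation preserving a strict order on a finite type is a power of `σ`, then the
corresponding poset has cyclic automorphism group of order `orderOf σ`. -/
lemma card_mem_posetSizes_of_perm {V : Type} [Finite V] (r : V → V → Prop)
    (hirr : ∀ x, ¬ r x x) (htr : ∀ x y z, r x y → r y z → r x z)
    (σ : Equiv.Perm V) (hσ : ∀ x y, r (σ x) (σ y) ↔ r x y)
    (h : ∀ τ : Equiv.Perm V, (∀ x y, r (τ x) (τ y) ↔ r x y) → τ ∈ Subgroup.zpowers σ) :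
    Nat.card V ∈ posetSizes.{u} (Multiplicative (ZMod (orderOf σ))) := by
  let po : PartialOrder (ULift.{u} V) :=
    { le := fun a b => a = b ∨ r a.down b.down
      le_refl := fun a => Or.inl rfl
      le_trans := by
        rintro a b c (rfl | hab) (rfl | hbc)
        · exact Or.inl rfl
        · exact Or.inr hbc
        · exact Or.inr hab
        · exact Or.inr (htr _ _ _ hab hbc)
      le_antisymm := by
        rintro a b (rfl | hab) (h | hba)
        · rfl
        · rfl
        · exact h.symm
        · exact absurd (htr _ _ _ hab hba) (hirr _) }
  have hle : ∀ a b : ULift.{u} V, a ≤ b ↔ a = b ∨ r a.down b.down := fun a b => Iff.rfl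
  have hr : ∀ a b : ULift.{u} V, r a.down b.down ↔ a ≤ b ∧ a ≠ b := by
    intro a b
    rw [hle]
    refine ⟨fun hab => ⟨Or.inr hab, ?_⟩, fun hab => hab.1.resolve_left hab.2⟩
    rintro rfl
    exact hirr _ hab
  refine ⟨ULift.{u} V, po, inferInstance, by simp, ?_⟩
  let Φ : (ULift.{u} V ≃o ULift.{u} V) →* Equiv.Perm V :=
    { toFun := fun f => (Equiv.ulift.symm.trans f.toEquiv).trans Equiv.ulift
      map_one' := by ext; rfl
      map_mul' := by intro f g; ext; rfl }
  have hΦ : ∀ f x, Φ f x = (f ⟨x⟩).down := fun f x => rfl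
  have hinj : Function.Injective Φ := by
    intro f g hfg
    ext x
    exact congrArg (fun τ : Equiv.Perm V => τ x.down) hfg
  have hpres : ∀ f x y, r (Φ f x) (Φ f y) ↔ r x y := by
    intro f x y
    rw [hΦ, hΦ, hr, show r x y ↔ _ from hr ⟨x⟩ ⟨y⟩]
    simp
  have hrange : Φ.range = Subgroup.zpowers σ := by
    apply le_antisymm
    · rintro _ ⟨f, rfl⟩
      exact h _ (hpres f)
    · rw [Subgroup.zpowers_le]
      refine ⟨⟨(Equiv.ulift.trans σ).trans Equiv.ulift.symm, ?_⟩, ?_⟩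
      · intro a b
        rw [hle, hle]
        simp [hσ]
      · ext x
        rfl
  refine ⟨(MonoidHom.ofInjective hinj).trans ((MulEquiv.subgroupCongr hrange).trans ?_)⟩
  refine mulEquivOfCyclicCardEq ?_
  rw [Nat.card_zpowers, Nat.card_congr Multiplicative.toAdd, Nat.card_zmod]

lemma add_mem_posetSizes {G H : Type v} [Group G] [Group H] {m k : ℕ}
    (hm : m ∈ posetSizes.{u} G) (hk : k ∈ posetSizes.{u} H) :
    m + k ∈ posetSizes.{u} (G × H) := by
  obtain ⟨P, _, _, rfl, ⟨eP⟩⟩ := hm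
  obtain ⟨Q, _, _, rfl, ⟨eQ⟩⟩ := hk
  refine ⟨P ⊕ₗ Q, inferInstance, inferInstanceAs (Finite (P ⊕ Q)), ?_, ?_⟩
  · rw [← Nat.card_sum]
    exact Nat.card_congr ofLex
  let Φ : (P ≃o P) × (Q ≃o Q) →* (P ⊕ₗ Q ≃o P ⊕ₗ Q) :=
    { toFun := fun f => OrderIso.sumLexCongr f.1 f.2
      map_one' := by ext (x | x) <;> rfl
      map_mul' := by rintro f g; ext (x | x) <;> rfl }
  have hΦl : ∀ f x, Φ f (toLex (Sum.inl x)) = toLex (Sum.inl (f.1 x)) := fun f x => rfl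
  have hΦr : ∀ f x, Φ f (toLex (Sum.inr x)) = toLex (Sum.inr (f.2 x)) := fun f x => rfl
  have hinj : Function.Injective Φ := by
    intro f g hfg
    have h := fun z => DFunLike.congr_fun hfg z
    ext x
    · simpa [hΦl] using h (toLex (Sum.inl x))
    · simpa [hΦr] using h (toLex (Sum.inr x))
  have hsurj : Function.Surjective Φ := by
    intro F
    let τ : Equiv.Perm (P ⊕ Q) := (toLex.trans F.toEquiv).trans ofLex
    have hτ : ∀ z, toLex (τ z) = F (toLex z) := fun z => rfl
    -- If a point `x` of `P` left `P`, then by finiteness some `t` of `Q` would enter it; but `x` is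
    -- below `t`, and no point of `Q` is below a point of `P`.
    have hmap : Set.MapsTo τ (Set.range Sum.inl) (Set.range Sum.inl) := by
      by_contra hcon
      simp only [Set.MapsTo, not_forall] at hcon
      obtain ⟨z, ⟨x, rfl⟩, hz⟩ := hcon
      have hne : ¬ Set.range (Sum.inl : P → P ⊕ Q) ⊆ τ '' Set.range Sum.inl := by
        intro hsub
        have heq := Set.eq_of_subset_of_ncard_le hsub
          (Set.ncard_image_of_injective _ τ.injective).le
        exact hz (heq ▸ Set.mem_image_of_mem τ (Set.mem_range_self x))
      obtain ⟨w, ⟨y, rfl⟩, hy⟩ := Set.not_subset.1 hne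
      obtain ⟨t, ht⟩ := τ.surjective (Sum.inl y)
      rcases t with t | t
      · exact hy ⟨_, Set.mem_range_self t, ht⟩
      have hlt : F (toLex (Sum.inl x)) ≤ F (toLex (Sum.inr t)) :=
        F.monotone (Sum.Lex.inl_le_inr x t)
      rw [← hτ, ← hτ, ht] at hlt
      rcases hx : τ (Sum.inl x) with s | s
      · exact hz ⟨s, hx.symm⟩
      · rw [hx] at hlt
        exact Sum.Lex.not_inr_le_inl hlt
    obtain ⟨⟨f, f'⟩, hf⟩ := Equiv.Perm.mem_sumCongrHom_range_of_perm_mapsTo_inl hmap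
    have hfl : ∀ x, F (toLex (Sum.inl x)) = toLex (Sum.inl (f x)) := fun x => by
      rw [← hτ, ← hf]; rfl
    have hfr : ∀ x, F (toLex (Sum.inr x)) = toLex (Sum.inr (f' x)) := fun x => by
      rw [← hτ, ← hf]; rfl
    refine ⟨(⟨f, ?_⟩, ⟨f', ?_⟩), ?_⟩
    · intro a b
      rw [← Sum.Lex.inl_le_inl_iff (β := Q), ← hfl, ← hfl, F.le_iff_le, Sum.Lex.inl_le_inl_iff]
    · intro a b
      rw [← Sum.Lex.inr_le_inr_iff (α := P), ← hfr, ← hfr, F.le_iff_le, Sum.Lex.inr_le_inr_iff]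
    · ext (x | x)
      · exact (hfl x).symm
      · exact (hfr x).symm
  exact ⟨(MulEquiv.ofBijective Φ ⟨hinj, hsurj⟩).symm.trans (eP.prodCongr eQ)⟩

lemma posetSizes_congr {G H : Type v} [Group G] [Group H] (e : G ≃* H) {m : ℕ}
    (hm : m ∈ posetSizes.{u} G) : m ∈ posetSizes.{u} H := by
  obtain ⟨P, po, hf, hc, ⟨f⟩⟩ := hm
  exact ⟨P, po, hf, hc, ⟨f.trans e⟩⟩

lemma add_mem_posetSizes_zmod {a b m k : ℕ} (hab : a.Coprime b)
    (hm : m ∈ posetSizes.{u} (Multiplicative (ZMod a)))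
    (hk : k ∈ posetSizes.{u} (Multiplicative (ZMod b))) :
    m + k ∈ posetSizes.{u} (Multiplicative (ZMod (a * b))) := by
  refine posetSizes_congr ?_ (add_mem_posetSizes hm hk)
  exact (MulEquiv.prodMultiplicative _ _).symm.trans
    (AddEquiv.toMultiplicative (ZMod.chineseRemainder hab).symm.toAddEquiv)

/-! ### Posets made of levels rotated simultaneously -/

/-- Rotation of all the levels of `ZMod n × L`. -/
def rotation (n : ℕ) (L : Type) : Equiv.Perm (ZMod n × L) :=
  (Equiv.addRight 1).prodCongr (Equiv.refl L)

lemma rotation_pow_apply (n : ℕ) {L : Type} (k : ℕ) (x : ZMod n × L) :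
    (rotation n L ^ k) x = (x.1 + k, x.2) := by
  induction k with
  | zero => simp
  | succ k ih =>
    rw [pow_succ', Equiv.Perm.mul_apply, ih]
    simp [rotation, add_assoc]

lemma orderOf_rotation (n : ℕ) (L : Type) [Nonempty L] : orderOf (rotation n L) = n := by
  apply Nat.dvd_antisymm
  · refine orderOf_dvd_of_pow_eq_one (Equiv.ext fun x => ?_)
    simp [rotation_pow_apply]
  · obtain ⟨l⟩ := ‹Nonempty L›
    have h := rotation_pow_apply n (orderOf (rotation n L)) (0, l)
    rw [pow_orderOf_eq_one] at h
    rw [← ZMod.natCast_eq_zero_iff]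
    simpa using (congrArg Prod.fst h).symm

lemma mul_card_mem_posetSizes_of_levels (n : ℕ) [NeZero n] {L : Type} [Finite L] [Nonempty L]
    (r : ZMod n × L → ZMod n × L → Prop)
    (hirr : ∀ x, ¬ r x x) (htr : ∀ x y z, r x y → r y z → r x z)
    (hσ : ∀ x y, r (rotation n L x) (rotation n L y) ↔ r x y)
    (h : ∀ τ : Equiv.Perm (ZMod n × L), (∀ x y, r (τ x) (τ y) ↔ r x y) →
      ∃ c, ∀ x, τ x = (x.1 + c, x.2)) :
    n * Nat.card L ∈ posetSizes.{u} (Multiplicative (ZMod n)) := by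
  have := card_mem_posetSizes_of_perm.{u} r hirr htr (rotation n L) hσ ?_
  · rwa [orderOf_rotation, Nat.card_prod, Nat.card_zmod] at this
  · intro τ hτ
    obtain ⟨c, hc⟩ := h τ hτ
    refine ⟨(c.val : ℤ), ?_⟩
    refine Equiv.ext fun x => ?_
    change (rotation n L ^ (c.val : ℤ)) x = τ x
    rw [zpow_natCast, rotation_pow_apply, hc]
    simp

lemma zero_mem_posetSizes : 0 ∈ posetSizes.{u} (Multiplicative (ZMod 1)) := by
  have := card_mem_posetSizes_of_perm.{u} (V := Empty) (fun _ _ => False) (fun _ h => h)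
    (fun _ _ _ h _ => h) 1 (fun _ _ => Iff.rfl) (fun τ _ => by
      rw [Subsingleton.elim τ 1]; exact one_mem _)
  rwa [orderOf_one, Nat.card_of_isEmpty] at this

lemma two_mem_posetSizes : 2 ∈ posetSizes.{u} (Multiplicative (ZMod 2)) := by
  have := mul_card_mem_posetSizes_of_levels.{u} 2 (L := Unit) (fun _ _ => False) (fun _ h => h)
    (fun _ _ _ h _ => h) (fun _ _ => Iff.rfl) (fun τ _ => ?_)
  · simpa using this
  · refine ⟨(τ (0, ())).1, ?_⟩
    revert τ
    decide

lemma apply_eq_add_of_apply_add_one {n : ℕ} [NeZero n] {f : ZMod n → ZMod n} {e : ZMod n}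
    (h : ∀ i, f (i + 1) = f i + e) (i : ZMod n) : f i = e * i + f 0 := by
  have key : ∀ k : ℕ, f (k : ZMod n) = e * k + f 0 := by
    intro k
    induction k with
    | zero => simp
    | succ k ih => rw [Nat.cast_succ, h, ih]; ring
  simpa using key i.val

/-- The middle level ties each bottom point to one top point, so an automorphism acts alike on all
levels. The extra relation from bottom `i` to top `i + 1` then orients the cycle, which excludes
reflections. -/
lemma mul_three_mem_posetSizes (n : ℕ) (hn : 2 ≤ n) :
    n * 3 ∈ posetSizes.{u} (Multiplicative (ZMod n)) := by
  have : NeZero n := ⟨by omega⟩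
  have : Fact (1 < n) := ⟨by omega⟩
  let r : ZMod n × Fin 3 → ZMod n × Fin 3 → Prop := fun x y =>
    (x.2 = 0 ∧ y.2 = 1 ∧ y.1 = x.1) ∨ (x.2 = 1 ∧ y.2 = 2 ∧ y.1 = x.1) ∨
      (x.2 = 0 ∧ y.2 = 2 ∧ (y.1 = x.1 ∨ y.1 = x.1 + 1))
  have := mul_card_mem_posetSizes_of_levels.{u} n r ?_ ?_ ?_ ?_
  · simpa using this
  · rintro ⟨i, k⟩ h
    simp only [r] at h
    omega
  · rintro ⟨i, k⟩ ⟨j, l⟩ ⟨t, m⟩ h1 h2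
    simp only [r] at h1 h2 ⊢
    rcases h1 with ⟨rfl, rfl, rfl⟩ | ⟨rfl, rfl, rfl⟩ | ⟨rfl, rfl, h⟩ <;> simp_all
  · rintro ⟨i, k⟩ ⟨j, l⟩
    simp [r, rotation]
  · intro τ hτ
    have h0 : ∀ i, (τ (i, 0)).2 = 0 := by
      intro i
      by_contra hne
      have : ∃ w, r w (τ (i, 0)) := by
        rcases (show (τ (i, 0)).2 = 1 ∨ (τ (i, 0)).2 = 2 by omega) with h | h
        · exact ⟨((τ (i, 0)).1, 0), by simp [r, h]⟩
        · exact ⟨((τ (i, 0)).1, 0), by simp [r, h]⟩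
      obtain ⟨w, hw⟩ := this
      obtain ⟨z, rfl⟩ := τ.surjective w
      rw [hτ] at hw
      simp [r] at hw
    have h2 : ∀ i, (τ (i, 2)).2 = 2 := by
      intro i
      by_contra hne
      have : ∃ w, r (τ (i, 2)) w := by
        rcases (show (τ (i, 2)).2 = 0 ∨ (τ (i, 2)).2 = 1 by omega) with h | h
        · exact ⟨((τ (i, 2)).1, 1), by simp [r, h]⟩
        · exact ⟨((τ (i, 2)).1, 2), by simp [r, h]⟩
      obtain ⟨w, hw⟩ := this
      obtain ⟨z, rfl⟩ := τ.surjective w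
      rw [hτ] at hw
      simp [r] at hw
    have h1 : ∀ i, (τ (i, 1)).2 = 1 ∧ (τ (i, 1)).1 = (τ (i, 0)).1 := by
      intro i
      have ha := (hτ (i, 0) (i, 1)).2 (by simp [r])
      have hb := (hτ (i, 1) (i, 2)).2 (by simp [r])
      simp only [r, h0, h2] at ha hb
      simp at ha hb
      rcases ha with ha | ha
      · exact ha
      · simp [ha] at hb
    have h12 : ∀ i, (τ (i, 2)).1 = (τ (i, 0)).1 := by
      intro i
      have hb := (hτ (i, 1) (i, 2)).2 (by simp [r])
      simp only [r, h1, h2] at hb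
      simpa using hb
    have hstep : ∀ i, (τ (i + 1, 0)).1 = (τ (i, 0)).1 + 1 := by
      intro i
      have ha := (hτ (i, 0) (i + 1, 2)).2 (by simp [r])
      simp only [r, h0, h2, h12] at ha
      simp at ha
      refine ha.resolve_left fun h => ?_
      have := τ.injective (Prod.ext h ((h0 _).trans (h0 _).symm))
      simp at this
    refine ⟨(τ (0, 0)).1, ?_⟩
    have hlin := apply_eq_add_of_apply_add_one (f := fun i => (τ (i, 0)).1) hstep
    rintro ⟨i, k⟩
    have hk : k = 0 ∨ k = 1 ∨ k = 2 := by omega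
    rcases hk with rfl | rfl | rfl
    · exact Prod.ext (by simpa using hlin i) (h0 i)
    · exact Prod.ext (by simpa [h1] using hlin i) (h1 i).1
    · exact Prod.ext (by simpa [h12] using hlin i) (h2 i)

/-! ### The poset with 20 points for the group of order 12 -/

/-- The strict order on `Fin 20` with automorphism group cyclic of order 12: the levels are
`{0, …, 3}`, `{4, …, 7} ∪ {8, …, 13}` and `{14, …, 19}`. -/
def ltTwenty (x y : Fin 20) : Bool :=
  if x.val < 4 then
    if y.val < 4 then false
    else if y.val < 8 then decide ((y.val - x.val) % 4 < 2)
    else if y.val < 14 then decide ((y.val - x.val) % 2 = 0)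
    else true
  else if y.val < 14 then false
  else if x.val < 8 then decide ((y.val + x.val) % 2 = 0)
  else if x.val < 14 then
    decide ((y.val - x.val) % 6 = 0 ∨ (y.val - x.val) % 6 = 1 ∨ (y.val - x.val) % 6 = 3)
  else false

def rotationTwenty : Equiv.Perm (Fin 20) where
  toFun := ![1, 2, 3, 0, 5, 6, 7, 4, 9, 10, 11, 12, 13, 8, 15, 16, 17, 18, 19, 14]
  invFun := ![3, 0, 1, 2, 7, 4, 5, 6, 13, 8, 9, 10, 11, 12, 19, 14, 15, 16, 17, 18]
  left_inv := by decide
  right_inv := by decide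

/-- An invariant of a pair of points under automorphisms of `ltTwenty`. -/
def pairType (x y : Fin 20) : Bool × Bool × ℕ :=
  (ltTwenty x y, ltTwenty y x,
    (Finset.univ.filter fun z => (ltTwenty x z && ltTwenty y z) = true).card)

lemma pairType_apply (τ : Equiv.Perm (Fin 20))
    (hτ : ∀ x y, ltTwenty (τ x) (τ y) = ltTwenty x y) (x y : Fin 20) :
    pairType (τ x) (τ y) = pairType x y := by
  simp only [pairType, hτ, Prod.mk.injEq, true_and]
  refine (Finset.card_bij (fun z _ => τ z) ?_ (fun _ _ _ _ h => τ.injective h) ?_).symm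
  · intro z hz
    simpa [hτ] using hz
  · intro w hw
    obtain ⟨z, rfl⟩ := τ.surjective w
    exact ⟨z, by simpa [hτ] using hw, rfl⟩

/-- Starting from 0 and 8, each further point is the only one with its pair types relative to at
most two points already known to be fixed. -/
lemma eq_one_of_fixes (τ : Equiv.Perm (Fin 20))
    (hτ : ∀ x y, ltTwenty (τ x) (τ y) = ltTwenty x y) (h0 : τ 0 = 0) (h8 : τ 8 = 8) : τ = 1 := by
  have step : ∀ k i j : Fin 20, (∀ w, pairType i w = pairType i k → pairType j w = pairType j k →
      w = k) → τ i = i → τ j = j → τ k = k := by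
    intro k i j h hi hj
    refine h _ ?_ ?_
    · conv_lhs => rw [← hi]
      exact pairType_apply τ hτ i k
    · conv_lhs => rw [← hj]
      exact pairType_apply τ hτ j k
  have h2 := step 2 0 0 (by decide +kernel) h0 h0
  have h5 := step 5 0 8 (by decide +kernel) h0 h8
  have h1 := step 1 0 5 (by decide +kernel) h0 h5
  have h3 := step 3 0 5 (by decide +kernel) h0 h5
  have h4 := step 4 0 5 (by decide +kernel) h0 h5
  have h6 := step 6 0 5 (by decide +kernel) h0 h5
  have h7 := step 7 0 5 (by decide +kernel) h0 h5
  have h11 := step 11 8 5 (by decide +kernel) h8 h5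
  have h14 := step 14 8 5 (by decide +kernel) h8 h5
  have h9 := step 9 5 14 (by decide +kernel) h5 h14
  have h12 := step 12 5 9 (by decide +kernel) h5 h9
  have h10 := step 10 14 12 (by decide +kernel) h14 h12
  have h13 := step 13 8 10 (by decide +kernel) h8 h10
  have h15 := step 15 8 11 (by decide +kernel) h8 h11
  have h16 := step 16 8 12 (by decide +kernel) h8 h12
  have h17 := step 17 8 10 (by decide +kernel) h8 h10
  have h18 := step 18 8 11 (by decide +kernel) h8 h11
  have h19 := step 19 8 5 (by decide +kernel) h8 h5
  ext x : 1
  fin_cases x <;> assumption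

lemma twenty_mem_posetSizes : 20 ∈ posetSizes.{u} (Multiplicative (ZMod 12)) := by
  have hσ : ∀ x y, ltTwenty (rotationTwenty x) (rotationTwenty y) = ltTwenty x y := by
    decide +kernel
  have hσk : ∀ (k : ℕ) x y,
      ltTwenty ((rotationTwenty ^ k) x) ((rotationTwenty ^ k) y) = ltTwenty x y := by
    intro k
    induction k with
    | zero => simp
    | succ k ih => intro x y; rw [pow_succ', Equiv.Perm.mul_apply, Equiv.Perm.mul_apply, hσ, ih]
  have hord : orderOf rotationTwenty = 12 := by
    rw [orderOf_eq_iff (by norm_num)]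
    decide +kernel
  have := card_mem_posetSizes_of_perm.{u} (fun x y => ltTwenty x y = true) (by decide +kernel)
    (by decide +kernel) rotationTwenty (fun x y => by rw [hσ]) (fun τ hτ' => ?_)
  · rwa [hord, Nat.card_eq_fintype_card, Fintype.card_fin] at this
  · have hτ : ∀ x y, ltTwenty (τ x) (τ y) = ltTwenty x y := fun x y =>
      Bool.eq_iff_iff.2 (hτ' x y)
    -- The minimal points are 0, 1, 2, 3, a single orbit of the rotation.
    obtain ⟨k, hk⟩ : ∃ k : Fin 12, τ 0 = (rotationTwenty ^ k.val) 0 := by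
      have hmin : ∀ z, ltTwenty z (τ 0) = false := by
        intro z
        obtain ⟨w, rfl⟩ := τ.surjective z
        rw [hτ]
        revert w
        decide +kernel
      have key : ∀ x, (∀ z, ltTwenty z x = false) →
          ∃ k : Fin 12, x = (rotationTwenty ^ k.val) 0 := by decide +kernel
      exact key _ hmin
    let τ' := (rotationTwenty ^ k.val)⁻¹ * τ
    have hτ1 : ∀ x y, ltTwenty (τ' x) (τ' y) = ltTwenty x y := by
      intro x y
      rw [← hσk k]
      simp [τ', hτ]
    have h0 : τ' 0 = 0 := by simp [τ', hk]
    obtain ⟨m, hm0, hm⟩ : ∃ m : Fin 12, (rotationTwenty ^ m.val) 0 = 0 ∧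
        (rotationTwenty ^ m.val) 8 = τ' 8 := by
      -- Points 4 to 7 also have three upper bounds. They are excluded by the last condition, that
      -- no other such point has the same upper bounds: these four share theirs in pairs.
      have key : ∀ x, pairType 0 x = pairType 0 8 → pairType x x = pairType 8 8 →
          (∀ y, pairType y y = pairType 8 8 → pairType x y = pairType 8 8 → y = x) →
          ∃ m : Fin 12, (rotationTwenty ^ m.val) 0 = 0 ∧ (rotationTwenty ^ m.val) 8 = x := by
        decide +kernel
      refine key _ ?_ (pairType_apply τ' hτ1 8 8) ?_
      · conv_lhs => rw [← h0]
        exact pairType_apply τ' hτ1 0 8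
      · intro y hy hy'
        obtain ⟨w, rfl⟩ := τ'.surjective y
        rw [pairType_apply τ' hτ1] at hy hy'
        congr 1
        revert w
        decide +kernel
    have h1 : (rotationTwenty ^ m.val)⁻¹ * τ' = 1 := by
      refine eq_one_of_fixes _ (fun x y => ?_) ?_ ?_
      · rw [← hσk m]
        simp [hτ1]
      · rw [Equiv.Perm.mul_apply, h0, Equiv.Perm.inv_eq_iff_eq, hm0]
      · simp [← hm]
    have h2 : τ = rotationTwenty ^ k.val * rotationTwenty ^ m.val := by
      rw [inv_mul_eq_one] at h1
      rw [h1]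
      simp [τ']
    rw [h2]
    exact mul_mem (Subgroup.npow_mem_zpowers _ _) (Subgroup.npow_mem_zpowers _ _)

/-! ### Two-level posets from subsets of `ZMod n` -/

/-- A walk on the cycle that changes direction revisits a point after two steps, which injectivity
forbids because 2 is nonzero. -/
lemma eq_add_or_eq_sub_of_forall_add_one {n : ℕ} [NeZero n] (hn : 3 ≤ n) (f : ZMod n → ZMod n)
    (hf : Function.Injective f) (h : ∀ i, f (i + 1) = f i + 1 ∨ f (i + 1) = f i - 1) :
    (∀ i, f i = i + f 0) ∨ ∀ i, f i = f 0 - i := by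
  have htwo : (2 : ZMod n) ≠ 0 := by
    have := ZMod.natCast_eq_zero_iff 2 n
    intro h2
    exact absurd (Nat.le_of_dvd (by norm_num) (this.1 (by exact_mod_cast h2))) (by omega)
  have hne : ∀ i, f (i + 1 + 1) ≠ f i := fun i hi => htwo (by
    have := hf hi
    rwa [add_assoc, add_eq_left, one_add_one_eq_two] at this)
  rcases h 0 with h0 | h0
  · left
    have key : ∀ k : ℕ, f ((k : ZMod n) + 1) = f k + 1 := by
      intro k
      induction k with
      | zero => simpa using h0
      | succ k ih =>
        push_cast
        refine (h _).resolve_right fun h' => hne k ?_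
        rw [h', ih]; ring
    intro i
    rw [apply_eq_add_of_apply_add_one (f := f) (e := 1) (fun i => by simpa using key i.val) i]
    ring
  · right
    have key : ∀ k : ℕ, f ((k : ZMod n) + 1) = f k - 1 := by
      intro k
      induction k with
      | zero => simpa using h0
      | succ k ih =>
        push_cast
        refine (h _).resolve_left fun h' => hne k ?_
        rw [h', ih]; ring
    intro i
    rw [apply_eq_add_of_apply_add_one (f := f) (e := -1)
      (fun i => by simpa [sub_eq_add_neg] using key i.val) i]
    ring

/-- The two-level poset on `ZMod n × Bool` with `(i, false) < (j, true)` iff `j - i ∈ S` has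
cyclic automorphism group if the overlap of `S` with its translates singles out `±1` and `S` is
asymmetric. -/
lemma mul_two_mem_posetSizes_of_finset (n : ℕ) (hn : 3 ≤ n) (S : Finset (ZMod n)) (k : ℕ)
    (hcount : ∀ t, (S.filter fun s => s - t ∈ S).card = k ↔ t = 1 ∨ t = -1)
    (hS : S.Nonempty) (hasym : ∀ c, ∃ s ∈ S, c - s ∉ S)
    (hstab : ∀ t, t ≠ 0 → ∃ s ∈ S, s + t ∉ S) :
    n * 2 ∈ posetSizes.{u} (Multiplicative (ZMod n)) := by
  have : NeZero n := ⟨by omega⟩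
  obtain ⟨s₀, hs₀⟩ := hS
  let r : ZMod n × Bool → ZMod n × Bool → Prop := fun x y =>
    x.2 = false ∧ y.2 = true ∧ y.1 - x.1 ∈ S
  have := mul_card_mem_posetSizes_of_levels.{u} n r ?_ ?_ ?_ ?_
  · simpa using this
  · rintro ⟨i, k⟩ ⟨h1, h2, -⟩
    exact absurd (h1.symm.trans h2) (by decide)
  · rintro ⟨i, k⟩ ⟨j, l⟩ ⟨t, m⟩ h1 h2
    simp_all [r]
  · rintro ⟨i, k⟩ ⟨j, l⟩
    simp [r, rotation]
  · intro τ hτ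
    have hf2 : ∀ i, (τ (i, false)).2 = false := fun i =>
      ((hτ (i, false) (i + s₀, true)).2 (by simp [r, hs₀])).1
    have hg2 : ∀ i, (τ (i, true)).2 = true := fun i =>
      ((hτ (i - s₀, false) (i, true)).2 (by simp [r, hs₀])).2.1
    obtain ⟨f, hf⟩ : ∃ f : ZMod n → ZMod n, ∀ i, τ (i, false) = (f i, false) :=
      ⟨fun i => (τ (i, false)).1, fun i => Prod.ext rfl (hf2 i)⟩
    obtain ⟨g, hg⟩ : ∃ g : ZMod n → ZMod n, ∀ i, τ (i, true) = (g i, true) :=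
      ⟨fun i => (τ (i, true)).1, fun i => Prod.ext rfl (hg2 i)⟩
    have hfinj : Function.Injective f := by
      intro i j hij
      have : τ (i, false) = τ (j, false) := by rw [hf, hf, hij]
      simpa using τ.injective this
    have hginj : Function.Injective g := by
      intro i j hij
      have : τ (i, true) = τ (j, true) := by rw [hg, hg, hij]
      simpa using τ.injective this
    have hfg : ∀ i j, g j - f i ∈ S ↔ j - i ∈ S := by
      intro i j
      have := hτ (i, false) (j, true)
      simpa [r, hf, hg] using this
    -- Both sides count the common upper bounds of two bottom points, a number that automorphisms
    -- preserve.
    have hcnt : ∀ i i', (S.filter fun s => s - (f i' - f i) ∈ S).card =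
        (S.filter fun s => s - (i' - i) ∈ S).card := by
      intro i i'
      refine (Finset.card_bij (fun s _ => g (s + i) - f i) ?_ ?_ ?_).symm
      · intro s hs
        rw [Finset.mem_filter] at hs ⊢
        refine ⟨(hfg _ _).2 (by simpa using hs.1), ?_⟩
        rw [sub_sub_sub_cancel_right, hfg]
        convert hs.2 using 1
        ring
      · intro s _ s' _ h
        simpa using hginj (sub_left_injective h)
      · intro s hs
        rw [Finset.mem_filter] at hs
        obtain ⟨j, hj⟩ := (Finite.surjective_of_injective hginj) (s + f i)
        refine ⟨j - i, ?_, by simp [hj]⟩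
        rw [Finset.mem_filter, show j - i - (i' - i) = j - i' by ring, ← hfg i j, ← hfg i' j, hj]
        refine ⟨by simpa using hs.1, ?_⟩
        convert hs.2 using 1
        ring
    have hstep : ∀ i, f (i + 1) = f i + 1 ∨ f (i + 1) = f i - 1 := by
      intro i
      have h := hcnt i (i + 1)
      rw [(hcount (i + 1 - i)).2 (by simp), hcount] at h
      rcases h with h | h
      · left; linear_combination h
      · right; linear_combination h
    -- A rotation of the bottom level determines the top level by `hstab`; a reflection would make
    -- `S` symmetric, against `hasym`.
    rcases eq_add_or_eq_sub_of_forall_add_one hn f hfinj hstep with h | h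
    · refine ⟨f 0, ?_⟩
      have hgj : ∀ j, g j = j + f 0 := by
        intro j
        by_contra hne
        obtain ⟨s, hs, hs'⟩ := hstab (g j - f 0 - j) (fun h0 => hne (by linear_combination h0))
        apply hs'
        have := (hfg (j - s) j).2 (by simpa using hs)
        rw [h] at this
        convert this using 1
        ring
      rintro ⟨i, b⟩
      cases b
      · rw [hf, h]
      · rw [hg, hgj]
    · exfalso
      obtain ⟨s, hs, hs'⟩ := hasym (g 0 - f 0)
      apply hs'
      have := (hfg (0 - s) 0).2 (by simpa using hs)
      rw [h] at this
      convert this using 1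
      ring

/-- Turns a congruence into linear arithmetic with at most one wraparound, the form in which `omega`
can settle it. -/
lemma natCast_sub_eq_natCast_iff {n : ℕ} [NeZero n] (a b : ℕ) (ha : a < n) (hb : b < n)
    (t : ZMod n) : (a : ZMod n) - t = b ↔ a = b + t.val ∨ a + n = b + t.val := by
  have ht := t.val_lt
  rw [sub_eq_iff_eq_add]
  conv_lhs => rw [← ZMod.natCast_zmod_val t, ← Nat.cast_add, ZMod.natCast_eq_natCast_iff']
  rw [Nat.mod_eq_of_lt ha]
  rcases lt_or_ge (b + t.val) n with h | h
  · rw [Nat.mod_eq_of_lt h]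
    omega
  · rw [Nat.mod_eq_sub_mod h, Nat.mod_eq_of_lt (by omega)]
    omega

/-- In the set 0, 1, 2, 5 the difference 1 occurs twice and 2, 3, 4, 5 once each. From `n = 11` on,
these and their negatives are distinct residues; for `n = 10` the difference 5 would also occur
twice. -/
lemma mul_two_mem_posetSizes_of_eleven_le (n : ℕ) (hn : 11 ≤ n) :
    n * 2 ∈ posetSizes.{u} (Multiplicative (ZMod n)) := by
  have : NeZero n := ⟨by omega⟩
  have key : ∀ (a b : ℕ) (t : ZMod n), a ≤ 5 → b ≤ 5 →
      ((a : ZMod n) - t = b ↔ a = b + t.val ∨ a + n = b + t.val) := fun a b t ha hb =>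
    natCast_sub_eq_natCast_iff a b (by omega) (by omega) t
  have inj : ∀ a b : ℕ, a < 11 → b < 11 → ((a : ZMod n) = b ↔ a = b) := fun a b ha hb => by
    have := natCast_sub_eq_natCast_iff a b (by omega) (by omega) (0 : ZMod n)
    simp only [sub_zero, ZMod.val_zero] at this
    rw [this]
    omega
  have hmem : ∀ x : ZMod n, x ∈ (({0, 1, 2, 5} : Finset ℕ).image (Nat.cast : ℕ → ZMod n)) ↔
      x = (0 : ℕ) ∨ x = (1 : ℕ) ∨ x = (2 : ℕ) ∨ x = (5 : ℕ) := by
    intro x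
    simp
  have hinj : Set.InjOn (Nat.cast : ℕ → ZMod n) (({0, 1, 2, 5} : Finset ℕ) : Set ℕ) := by
    intro a ha b hb hab
    simp only [Finset.coe_insert, Finset.coe_singleton, Set.mem_insert_iff,
      Set.mem_singleton_iff] at ha hb
    exact (inj a b (by omega) (by omega)).1 hab
  refine mul_two_mem_posetSizes_of_finset n (by omega)
    (({0, 1, 2, 5} : Finset ℕ).image Nat.cast) 2 ?_ (by simp) ?_ ?_
  · intro t
    have ht := t.val_lt
    have h1 : t = 1 ↔ t.val = 1 := by
      have := key 1 0 t (by norm_num) (by norm_num)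
      rw [Nat.cast_zero, sub_eq_zero, eq_comm, Nat.cast_one] at this
      rw [this]; omega
    have h2 : t = -1 ↔ t.val + 1 = n := by
      have := key 0 1 t (by norm_num) (by norm_num)
      rw [Nat.cast_zero, zero_sub, neg_eq_iff_eq_neg, Nat.cast_one] at this
      rw [this]; omega
    rw [h1, h2, Finset.filter_image, Finset.card_image_of_injOn
      (hinj.mono (Finset.coe_subset.2 (Finset.filter_subset _ _))), Finset.card_filter]
    simp only [hmem]
    rw [Finset.sum_insert (by simp), Finset.sum_insert (by simp), Finset.sum_insert (by simp),
      Finset.sum_singleton]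
    simp only [key, Nat.zero_le, Nat.reduceLeDiff, le_refl]
    split_ifs <;> first | omega | (simp only [false_iff]; omega)
  · intro c
    by_contra! hcon
    obtain ⟨a, ha, rfl⟩ : ∃ a : ℕ, (a = 0 ∨ a = 1 ∨ a = 2 ∨ a = 5) ∧ c = a := by
      have := (hmem _).1 (hcon 0 ((hmem 0).2 (by simp)))
      rw [sub_zero] at this
      rcases this with h | h | h | h
      · exact ⟨0, by simp, h⟩
      · exact ⟨1, by simp, h⟩
      · exact ⟨2, by simp, h⟩
      · exact ⟨5, by simp, h⟩
    have hval : ∀ s : ℕ, s ≤ 5 → (s : ZMod n).val = s := fun s hs =>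
      ZMod.val_natCast_of_lt (by omega)
    have h1 := (hmem _).1 (hcon (1 : ℕ) ((hmem _).2 (by simp)))
    have h2 := (hmem _).1 (hcon (2 : ℕ) ((hmem _).2 (by simp)))
    have h5 := (hmem _).1 (hcon (5 : ℕ) ((hmem _).2 (by simp)))
    rw [key _ _ _ (by omega) (by omega), key _ _ _ (by omega) (by omega),
      key _ _ _ (by omega) (by omega), key _ _ _ (by omega) (by omega), hval _ (by omega)]
      at h1 h2 h5
    omega
  · intro t ht
    by_contra! hcon
    have h0 := (hmem _).1 (hcon 0 ((hmem 0).2 (by simp)))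
    rw [zero_add] at h0
    have h1 := (hmem _).1 (hcon (1 : ℕ) ((hmem _).2 (by simp)))
    have h2 := (hmem _).1 (hcon (2 : ℕ) ((hmem _).2 (by simp)))
    rcases h0 with rfl | rfl | rfl | rfl
    · simp at ht
    all_goals
      rw [← Nat.cast_add, inj _ _ (by omega) (by omega), inj _ _ (by omega) (by omega),
        inj _ _ (by omega) (by omega), inj _ _ (by omega) (by omega)] at h1 h2
      omega

/-- The differences ±1 occur once each and all other nonzero differences twice. -/
lemma sixteen_mem_posetSizes : 8 * 2 ∈ posetSizes.{u} (Multiplicative (ZMod 8)) :=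
  mul_two_mem_posetSizes_of_finset 8 (by norm_num) {0, 1, 3, 5} 1 (by decide) (by decide)
    (by decide) (by decide)

/-- The only nonzero residues that are not differences are ±1. -/
lemma eighteen_mem_posetSizes : 9 * 2 ∈ posetSizes.{u} (Multiplicative (ZMod 9)) :=
  mul_two_mem_posetSizes_of_finset 9 (by norm_num) {0, 2, 5} 0 (by decide) (by decide)
    (by decide) (by decide)

/-! ### The upper bound -/

lemma weightedSum_mul {m n : ℕ} (h : m.Coprime n) :
    weightedSum (m * n) = weightedSum m + weightedSum n := by
  rw [weightedSum, h.primeFactors_mul, Finset.sum_union h.disjoint_primeFactors]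
  congr 1
  · refine Finset.sum_congr rfl fun p hp => ?_
    rw [Nat.factorization_eq_of_coprime_left h (by simpa using hp)]
  · refine Finset.sum_congr rfl fun p hp => ?_
    rw [Nat.factorization_eq_of_coprime_right h (by simpa using hp)]

lemma weightedSum_prime_pow {p r : ℕ} (hp : p.Prime) (hr : r ≠ 0) :
    weightedSum (p ^ r) = b (p ^ r) * p ^ r := by
  rw [weightedSum, Nat.primeFactors_prime_pow hr hp, Finset.sum_singleton,
    hp.factorization_pow, Finsupp.single_eq_same]

lemma b_mul_mem_posetSizes {p r : ℕ} (hp : p.Prime) (hr : r ≠ 0) :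
    b (p ^ r) * p ^ r ∈ posetSizes.{u} (Multiplicative (ZMod (p ^ r))) := by
  have hcard : (p ^ r).primeFactors.card = 1 := by
    rw [Nat.primeFactors_prime_pow hr hp, Finset.card_singleton]
  have h2 : 2 ≤ p ^ r := hp.two_le.trans (Nat.le_self_pow hr p)
  generalize p ^ r = q at hcard h2
  -- With 6 and 10 excluded as non-prime-powers, only 8, 9 and `q ≥ 11` remain for the two-level
  -- construction.
  have h6 : q ≠ 6 := by
    rintro rfl
    revert hcard
    decide +kernel
  have h10 : q ≠ 10 := by
    rintro rfl
    revert hcard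
    decide +kernel
  by_cases hq2 : q = 2
  · subst hq2
    exact two_mem_posetSizes
  by_cases hq3 : q = 3 ∨ q = 4 ∨ q = 5 ∨ q = 7
  · rw [b, if_neg (by omega), if_neg hq2, if_pos hq3, mul_comm]
    exact mul_three_mem_posetSizes q h2
  rw [b, if_neg (by omega), if_neg hq2, if_neg hq3, mul_comm]
  by_cases hq8 : q = 8
  · subst hq8
    exact sixteen_mem_posetSizes
  by_cases hq9 : q = 9
  · subst hq9
    exact eighteen_mem_posetSizes
  exact mul_two_mem_posetSizes_of_eleven_le q (by omega)

lemma weightedSum_mem_posetSizes (n : ℕ) (hn : n ≠ 0) :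
    weightedSum n ∈ posetSizes.{u} (Multiplicative (ZMod n)) := by
  induction n using Nat.recOnPosPrimePosCoprime with
  | prime_pow p r hp hr =>
    rw [weightedSum_prime_pow hp hr.ne']
    exact b_mul_mem_posetSizes hp hr.ne'
  | zero => exact absurd rfl hn
  | one => simpa [weightedSum] using zero_mem_posetSizes
  | coprime a b ha hb hab iha ihb =>
    rw [weightedSum_mul hab]
    exact add_mem_posetSizes_zmod hab (iha (by omega)) (ihb (by omega))

lemma weightedSum_sub_one_mem_posetSizes (n : ℕ) (hn : n ≠ 0) (h3 : ExactlyDivides 3 1 n)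
    (h4 : ExactlyDivides 2 2 n) :
    weightedSum n - 1 ∈ posetSizes.{u} (Multiplicative (ZMod n)) := by
  obtain ⟨m, rfl⟩ : 12 ∣ n :=
    Nat.Coprime.mul_dvd_of_dvd_of_dvd (m := 3) (n := 4) (by norm_num) (by simpa using h3.1)
      (by simpa using h4.1)
  have hm3 : ¬ 3 ∣ m := fun h => h3.2 (mul_dvd_mul (a := 3) (by norm_num) h)
  have hm2 : ¬ 2 ∣ m := fun h => h4.2 (mul_dvd_mul (a := 4) (by norm_num) h)
  have hcop : Nat.Coprime 12 m := by
    rw [show 12 = 3 * 2 ^ 2 by norm_num]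
    exact Nat.Coprime.mul_left ((Nat.Prime.coprime_iff_not_dvd Nat.prime_three).2 hm3)
      (((Nat.Prime.coprime_iff_not_dvd Nat.prime_two).2 hm2).pow_left 2)
  have h12 : weightedSum 12 = 21 := by
    rw [show 12 = 3 ^ 1 * 2 ^ 2 by norm_num, weightedSum_mul (by norm_num),
      weightedSum_prime_pow Nat.prime_three (by norm_num),
      weightedSum_prime_pow Nat.prime_two (by norm_num)]
    simp [b]
  rw [weightedSum_mul hcop, h12, show 21 + weightedSum m - 1 = 20 + weightedSum m by omega]
  exact add_mem_posetSizes_zmod hcop twenty_mem_posetSizes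
    (weightedSum_mem_posetSizes m (by rintro rfl; simp at hn))

/-! ### Inequalities between sums and products -/

lemma sum_le_prod_of_three_le {ι : Type*} [DecidableEq ι] (T : Finset ι) (Q : ι → ℕ)
    (hQ : ∀ i ∈ T, 3 ≤ Q i) (hT : T.Nonempty) : ∑ i ∈ T, Q i ≤ ∏ i ∈ T, Q i := by
  induction hT using Finset.Nonempty.cons_induction with
  | singleton a => simp
  | cons a s ha hs ih =>
    rw [Finset.sum_cons, Finset.prod_cons]
    have h1 := ih fun i hi => hQ i (Finset.mem_cons_of_mem hi)
    have h2 := hQ a (Finset.mem_cons_self a s)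
    obtain ⟨j, hj⟩ := hs
    have h3 := hQ j (Finset.mem_cons_of_mem hj)
    have h4 := Finset.single_le_sum (f := Q) (fun i _ => Nat.zero_le _) hj
    nlinarith

/-- Sharp for two factors equal to 3. It makes even the coefficient 3 affordable as soon as an orbit
length has two of the relevant factors. -/
lemma three_mul_sum_le_two_mul_prod {ι : Type*} [DecidableEq ι] (T : Finset ι) (Q : ι → ℕ)
    (hQ : ∀ i ∈ T, 3 ≤ Q i) (hT : 2 ≤ T.card) : 3 * ∑ i ∈ T, Q i ≤ 2 * ∏ i ∈ T, Q i := by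
  obtain ⟨a, ha⟩ : T.Nonempty := Finset.card_pos.1 (by omega)
  have hs : (T.erase a).Nonempty := Finset.card_pos.1 (by rw [Finset.card_erase_of_mem ha]; omega)
  rw [← Finset.add_sum_erase T Q ha, ← Finset.mul_prod_erase T Q ha]
  have hQ' : ∀ i ∈ T.erase a, 3 ≤ Q i := fun i hi => hQ i (Finset.mem_of_mem_erase hi)
  have h1 := sum_le_prod_of_three_le _ Q hQ' hs
  have h2 := hQ a ha
  obtain ⟨j, hj⟩ := hs
  have h3 := hQ' j hj
  have h4 := Finset.single_le_sum (f := Q) (fun i _ => Nat.zero_le _) hj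
  nlinarith

lemma prod_le_of_pairwise_coprime {ι : Type*} (T : Finset ι) (Q : ι → ℕ) {l : ℕ} (hl : 0 < l)
    (hdvd : ∀ i ∈ T, Q i ∣ l) (hco : (T : Set ι).Pairwise (Function.onFun Nat.Coprime Q)) :
    ∏ i ∈ T, Q i ≤ l :=
  Nat.le_of_dvd hl (Finset.prod_dvd_of_isRelPrime
    (fun _ hi _ hj hij => Nat.coprime_iff_isRelPrime.1 (hco hi hj hij)) hdvd)

lemma weight_le_three_mul_sum {ι : Type*} (T : Finset ι) (Q c : ι → ℕ)
    (hc : ∀ i, c i = 2 ∨ c i = 3) : ∑ i ∈ T, c i * Q i ≤ 3 * ∑ i ∈ T, Q i := by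
  rw [Finset.mul_sum]
  refine Finset.sum_le_sum fun i _ => Nat.mul_le_mul_right _ ?_
  have := hc i
  omega

/-- A weighted sum of coprime divisors at least 3 of `l`, with weights 2 or 3. -/
lemma weight_le_two_mul {ι : Type*} [DecidableEq ι] (T : Finset ι) (Q c : ι → ℕ) {l : ℕ}
    (hl : 0 < l) (hQ : ∀ i ∈ T, 3 ≤ Q i) (hdvd : ∀ i ∈ T, Q i ∣ l)
    (hco : (T : Set ι).Pairwise (Function.onFun Nat.Coprime Q))
    (hc : ∀ i, c i = 2 ∨ c i = 3) (hc3 : ∀ i ∈ T, c i = 3 → l ≠ Q i) :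
    ∑ i ∈ T, c i * Q i ≤ 2 * l := by
  have hprod := prod_le_of_pairwise_coprime T Q hl hdvd hco
  rcases lt_trichotomy T.card 1 with h | h | h
  · rw [Finset.card_eq_zero.1 (Nat.lt_one_iff.1 h), Finset.sum_empty]
    exact Nat.zero_le _
  · obtain ⟨i, rfl⟩ := Finset.card_eq_one.1 h
    rw [Finset.sum_singleton]
    have hi := Finset.mem_singleton_self i
    obtain ⟨k, rfl⟩ := hdvd i hi
    have hQi := hQ i hi
    rcases hc i with h2 | h3
    · rw [h2]
      have : 1 ≤ k := Nat.pos_of_ne_zero (by rintro rfl; simp at hl)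
      nlinarith
    · have hk : 2 ≤ k := by
        by_contra hk
        have : k = 0 ∨ k = 1 := by omega
        rcases this with rfl | rfl
        · simp at hl
        · exact hc3 i hi h3 (by simp)
      rw [h3]
      nlinarith
  · have := three_mul_sum_le_two_mul_prod T Q hQ h
    have := weight_le_three_mul_sum T Q c hc
    omega

/-- Applied with `m` half the length of an orbit of length 2 modulo 4. The tight case is a single
factor `Q i = m` with coefficient 3, whose slack is `m`; it falls below 4 only for `m = 3`. -/
lemma weight_add_four_le_four_mul {ι : Type*} [DecidableEq ι] (T : Finset ι) (Q c : ι → ℕ)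
    {m : ℕ} (hm : 0 < m) (hQ : ∀ i ∈ T, 3 ≤ Q i) (hdvd : ∀ i ∈ T, Q i ∣ m)
    (hco : (T : Set ι).Pairwise (Function.onFun Nat.Coprime Q))
    (hc : ∀ i, c i = 2 ∨ c i = 3) :
    ∑ i ∈ T, c i * Q i + 4 ≤ 4 * m ∨
      m = 3 ∧ (∃ i ∈ T, Q i = 3 ∧ c i = 3) ∧ ∑ i ∈ T, c i * Q i + 3 ≤ 4 * m := by
  have hprod := prod_le_of_pairwise_coprime T Q hm hdvd hco
  rcases lt_trichotomy T.card 1 with h | h | h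
  · rw [Finset.card_eq_zero.1 (Nat.lt_one_iff.1 h), Finset.sum_empty]
    omega
  · obtain ⟨i, rfl⟩ := Finset.card_eq_one.1 h
    rw [Finset.sum_singleton]
    have hi := Finset.mem_singleton_self i
    have hle := Nat.le_of_dvd hm (hdvd i hi)
    have hQi := hQ i hi
    rcases hc i with h2 | h3
    · rw [h2]
      omega
    · by_cases hm3 : m = 3
      · exact Or.inr ⟨hm3, ⟨i, hi, by omega, h3⟩, by rw [h3]; omega⟩
      · rw [h3]
        omega
  · have h1 := three_mul_sum_le_two_mul_prod T Q hQ h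
    have h2 := weight_le_three_mul_sum T Q c hc
    obtain ⟨i, hi⟩ : T.Nonempty := Finset.card_pos.1 (by omega)
    have := Nat.le_of_dvd hm (hdvd i hi)
    have := hQ i hi
    omega

lemma sum_add_add_le_of_two {Ω : Type*} [Fintype Ω] [DecidableEq Ω] (f g : Ω → ℕ)
    (hfg : ∀ O, f O ≤ g O) {C D : Ω} (hCD : C ≠ D) {x y : ℕ} (hC : f C + x ≤ g C)
    (hD : f D + y ≤ g D) : ∑ O, f O + x + y ≤ ∑ O, g O := by
  have h : ∑ O, (f O + (if O = C then x else 0) + if O = D then y else 0) ≤ ∑ O, g O := by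
    refine Finset.sum_le_sum fun O _ => ?_
    have := hfg O
    split_ifs with h1 h2 h2
    · exact absurd (h1.symm.trans h2) hCD
    · subst h1; omega
    · subst h2; omega
    · omega
  simpa [Finset.sum_add_distrib] using h

lemma sum_add_le_of_one {Ω : Type*} [Fintype Ω] [DecidableEq Ω] (f g : Ω → ℕ)
    (hfg : ∀ O, f O ≤ g O) {C : Ω} {x : ℕ} (hC : f C + x ≤ g C) :
    ∑ O, f O + x ≤ ∑ O, g O := by
  have h : ∑ O, (f O + if O = C then x else 0) ≤ ∑ O, g O := by
    refine Finset.sum_le_sum fun O _ => ?_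
    have := hfg O
    split_ifs with h1
    · subst h1; omega
    · omega
  simpa [Finset.sum_add_distrib] using h

/-! ### Weighing the orbits -/

/-- The combinatorial properties of the orbit lengths `l` of a cyclic automorphism group of order
`n` of a finite poset which force a lower bound for the number of points. -/
structure OrbitLengths {Ω : Type*} (n : ℕ) (l : Ω → ℕ) : Prop where
  dvd : ∀ O, l O ∣ n
  exists_dvd : ∀ p, p.Prime → p ∣ n → ∃ O, p ^ n.factorization p ∣ l O
  exists_ne : ∀ p, p.Prime → p ∣ n → p ^ n.factorization p ≠ 2 →
    ∀ A, ∃ B, B ≠ A ∧ p ^ n.factorization p ∣ l B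
  exists_third : ∀ p, p.Prime → p = 3 ∨ p = 5 ∨ p = 7 → n.factorization p = 1 →
    ∀ A B, A ≠ B → p ∣ l A → p ∣ l B → (l A).gcd (l B) = p → ∃ C, C ≠ A ∧ C ≠ B ∧ p ∣ l C
  exists_third_four : n.factorization 2 = 2 →
    ∀ A B, A ≠ B → 4 ∣ l A → 4 ∣ l B → (l A).gcd (l B) = 4 →
      (∃ C, C ≠ A ∧ C ≠ B ∧ 4 ∣ l C) ∨
      ∃ C D, C ≠ D ∧ (C ≠ A ∧ C ≠ B) ∧ (D ≠ A ∧ D ≠ B) ∧ 2 ∣ l C ∧ 2 ∣ l D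

open Classical in
/-- Twice the weight of an orbit of length divisible by the exact power of `p` in `n`: it is 3 if
there are just two such orbits and their lengths share a further factor, and 2 otherwise. -/
noncomputable def orbitCoeff {Ω : Type*} [Fintype Ω] (n : ℕ) (l : Ω → ℕ) (p : ℕ) : ℕ :=
  if (Finset.univ.filter fun O => p ^ n.factorization p ∣ l O).card = 2 ∧
    ∀ A B, A ≠ B → p ^ n.factorization p ∣ l A → p ^ n.factorization p ∣ l B →
      (l A).gcd (l B) ≠ p ^ n.factorization p
  then 3 else 2

lemma orbitCoeff_eq {Ω : Type*} [Fintype Ω] (n : ℕ) (l : Ω → ℕ) (p : ℕ) :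
    orbitCoeff n l p = 2 ∨ orbitCoeff n l p = 3 := by
  unfold orbitCoeff
  split_ifs <;> simp

lemma gcd_ne_of_orbitCoeff_eq_three {Ω : Type*} [Fintype Ω] {n : ℕ} {l : Ω → ℕ} {p : ℕ}
    (h : orbitCoeff n l p = 3) {A B : Ω} (hAB : A ≠ B) (hA : p ^ n.factorization p ∣ l A)
    (hB : p ^ n.factorization p ∣ l B) : (l A).gcd (l B) ≠ p ^ n.factorization p := by
  unfold orbitCoeff at h
  split_ifs at h with h'
  · exact h'.2 A B hAB hA hB
  · omega

/-- The primes whose exact power in `n` is not 2. -/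
def bigPrimes (n : ℕ) : Finset ℕ := n.primeFactors.filter fun p => p ^ n.factorization p ≠ 2

-- Weights are doubled throughout, so that they are compared with twice the orbit length and stay
-- integral.
open Classical in
noncomputable def orbitWeight {Ω : Type*} [Fintype Ω] (n : ℕ) (l : Ω → ℕ) (O : Ω) : ℕ :=
  ∑ p ∈ (bigPrimes n).filter (fun p => p ^ n.factorization p ∣ l O),
    orbitCoeff n l p * p ^ n.factorization p

lemma three_le_of_mem_bigPrimes {n p : ℕ} (hp : p ∈ bigPrimes n) : 3 ≤ p ^ n.factorization p := by
  rw [bigPrimes, Finset.mem_filter] at hp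
  have h1 := Nat.prime_of_mem_primeFactors hp.1
  have h2 : n.factorization p ≠ 0 := by
    rw [← Finsupp.mem_support_iff, Nat.support_factorization]
    exact hp.1
  have := h1.two_le.trans (Nat.le_self_pow h2 p)
  have := hp.2
  omega

lemma pairwise_coprime_bigPrimes (n : ℕ) (s : Set ℕ) (hs : s ⊆ bigPrimes n) :
    s.Pairwise (Function.onFun Nat.Coprime fun p => p ^ n.factorization p) := by
  intro p hp q hq hpq
  have h1 := hs hp
  have h2 := hs hq
  simp only [bigPrimes, Finset.mem_coe, Finset.mem_filter] at h1 h2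
  exact Nat.coprime_pow_primes _ _ (Nat.prime_of_mem_primeFactors h1.1)
    (Nat.prime_of_mem_primeFactors h2.1) hpq

namespace OrbitLengths

variable {Ω : Type*} [Fintype Ω] {n : ℕ} {l : Ω → ℕ}

/-- A prime power with coefficient 3 cannot be the whole length of `O`: a second orbit of length
divisible by it would have exactly that gcd with `O`. -/
lemma orbitWeight_le (h : OrbitLengths n l) (hn : n ≠ 0) (O : Ω) :
    orbitWeight n l O ≤ 2 * l O := by
  classical
  refine weight_le_two_mul _ _ _ (Nat.pos_of_dvd_of_pos (h.dvd O) (Nat.pos_of_ne_zero hn))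
    (fun p hp => three_le_of_mem_bigPrimes (Finset.mem_filter.1 hp).1)
    (fun p hp => (Finset.mem_filter.1 hp).2)
    (pairwise_coprime_bigPrimes n _ (Finset.coe_subset.2 (Finset.filter_subset _ _)))
    (orbitCoeff_eq n l) ?_
  intro p hp h3 hl
  rw [Finset.mem_filter, bigPrimes, Finset.mem_filter] at hp
  obtain ⟨B, hB, hBl⟩ := h.exists_ne p (Nat.prime_of_mem_primeFactors hp.1.1)
    (Nat.dvd_of_mem_primeFactors hp.1.1) hp.1.2 O
  refine gcd_ne_of_orbitCoeff_eq_three h3 hB hBl hp.2 ?_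
  rw [hl]
  exact Nat.gcd_eq_right hBl

lemma orbitWeight_add_le (h : OrbitLengths n l) (hn : n ≠ 0) {O : Ω} (h2 : 2 ∣ l O)
    (h4 : ¬ 4 ∣ l O) : orbitWeight n l O + 4 ≤ 2 * l O ∨
      l O = 6 ∧ n.factorization 3 = 1 ∧ orbitCoeff n l 3 = 3 ∧
        orbitWeight n l O + 3 ≤ 2 * l O := by
  classical
  obtain ⟨m, hm⟩ := h2
  have hpos := Nat.pos_of_dvd_of_pos (h.dvd O) (Nat.pos_of_ne_zero hn)
  have key := weight_add_four_le_four_mul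
    ((bigPrimes n).filter (fun p => p ^ n.factorization p ∣ l O)) (fun p => p ^ n.factorization p)
    (orbitCoeff n l) (m := m) (by omega)
    (fun p hp => three_le_of_mem_bigPrimes (Finset.mem_filter.1 hp).1) ?_
    (pairwise_coprime_bigPrimes n _ (Finset.coe_subset.2 (Finset.filter_subset _ _)))
    (orbitCoeff_eq n l)
  · rw [orbitWeight, hm, ← mul_assoc]
    rw [hm] at key
    refine key.imp id ?_
    rintro ⟨rfl, ⟨p, hp, hp3, hc⟩, hle⟩
    have hp' := (Finset.mem_filter.1 (Finset.mem_filter.1 hp).1).1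
    have hpp := Nat.prime_of_mem_primeFactors hp'
    have hr : n.factorization p ≠ 0 := by
      rwa [← Finsupp.mem_support_iff, Nat.support_factorization]
    obtain rfl : p = 3 := (Nat.prime_dvd_prime_iff_eq hpp Nat.prime_three).1
      (hp3 ▸ dvd_pow_self p hr)
    exact ⟨rfl, Nat.pow_right_injective (show 2 ≤ 3 by norm_num)
      (hp3.trans (pow_one 3).symm), hc, hle⟩
  · intro p hp
    obtain ⟨hpJ, hpd⟩ := Finset.mem_filter.1 hp
    have hp' := (Finset.mem_filter.1 hpJ).1
    have hpp := Nat.prime_of_mem_primeFactors hp'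
    have h3 := three_le_of_mem_bigPrimes hpJ
    have hp2 : p ≠ 2 := by
      rintro rfl
      have : 2 ≤ n.factorization 2 := by
        by_contra hlt
        have := Nat.pow_le_pow_right (n := 2) (by norm_num) (show n.factorization 2 ≤ 1 by omega)
        omega
      exact h4 ((pow_dvd_pow 2 this).trans hpd)
    rw [hm] at hpd
    exact (Nat.Coprime.pow_left _ ((Nat.coprime_primes hpp Nat.prime_two).2 hp2)).dvd_of_dvd_mul_left
      hpd

open Classical in
lemma sum_orbitWeight : ∑ O, orbitWeight n l O = ∑ p ∈ bigPrimes n,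
    (Finset.univ.filter fun O => p ^ n.factorization p ∣ l O).card *
      (orbitCoeff n l p * p ^ n.factorization p) := by
  simp only [orbitWeight, Finset.sum_filter]
  rw [Finset.sum_comm]
  refine Finset.sum_congr rfl fun p _ => ?_
  rw [← Finset.sum_filter, Finset.sum_const, smul_eq_mul]

open Classical in
/-- Either the orbits of length divisible by the exact power of `p` contribute enough, or `p = 2`
and there are two further orbits of even length. -/
lemma two_mul_b_le (h : OrbitLengths n l) {p : ℕ} (hp : p ∈ bigPrimes n) :
    2 * b (p ^ n.factorization p) ≤ (Finset.univ.filter fun O => p ^ n.factorization p ∣ l O).card *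
      orbitCoeff n l p ∨
    (p = 2 ∧ n.factorization 2 = 2 ∧
      8 ≤ (Finset.univ.filter fun O => p ^ n.factorization p ∣ l O).card * orbitCoeff n l p * 2 ∧
      ∃ C D, C ≠ D ∧ (2 ∣ l C ∧ ¬ 4 ∣ l C) ∧ (2 ∣ l D ∧ ¬ 4 ∣ l D)) := by
  have h3 := three_le_of_mem_bigPrimes hp
  rw [bigPrimes, Finset.mem_filter] at hp
  have hpp := Nat.prime_of_mem_primeFactors hp.1
  have hpn := Nat.dvd_of_mem_primeFactors hp.1
  obtain ⟨A, hA⟩ := h.exists_dvd p hpp hpn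
  obtain ⟨B, hBA, hB⟩ := h.exists_ne p hpp hpn hp.2 A
  set M := Finset.univ.filter fun O => p ^ n.factorization p ∣ l O with hM
  have hsub : {A, B} ⊆ M := by
    intro O hO
    rw [Finset.mem_insert, Finset.mem_singleton] at hO
    rcases hO with rfl | rfl <;> simp [hM, hA, hB]
  have hcard : 2 ≤ M.card := by
    rw [← Finset.card_pair hBA.symm]
    exact Finset.card_le_card hsub
  have hc := orbitCoeff_eq n l p
  have hc2 : 2 ≤ orbitCoeff n l p := by omega
  have hmul : 4 ≤ M.card * orbitCoeff n l p := by nlinarith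
  -- Two orbits with coefficient at least 2 already pay for `b = 2`. The value 3 needs a third orbit
  -- or coefficient 3; failing both, some pair has gcd exactly the prime power.
  by_cases hb : b (p ^ n.factorization p) ≤ 2
  · left; omega
  by_cases hM3 : 3 ≤ M.card
  · left
    have : b (p ^ n.factorization p) ≤ 3 := by unfold b; split_ifs <;> omega
    nlinarith
  have hM2 : M.card = 2 := by omega
  have hMeq : {A, B} = M := Finset.eq_of_subset_of_card_le hsub (by
    rw [Finset.card_pair hBA.symm, hM2])
  have hthird : ∀ C, p ^ n.factorization p ∣ l C → C = A ∨ C = B := by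
    intro C hC
    have : C ∈ M := by simp [hM, hC]
    rwa [← hMeq, Finset.mem_insert, Finset.mem_singleton] at this
  by_cases hc3 : orbitCoeff n l p = 3
  · left
    have : b (p ^ n.factorization p) ≤ 3 := by unfold b; split_ifs <;> omega
    rw [hM2, hc3]; omega
  obtain ⟨A', B', hAB', hA', hB', hgcd⟩ : ∃ A B, A ≠ B ∧ p ^ n.factorization p ∣ l A ∧
      p ^ n.factorization p ∣ l B ∧ (l A).gcd (l B) = p ^ n.factorization p := by
    by_contra! hcon
    exact hc3 (if_pos ⟨hM2, fun A B h1 h2 h3 => hcon A B h1 h2 h3⟩)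
  have hthird' : ∀ C, C ≠ A' → C ≠ B' → ¬ p ^ n.factorization p ∣ l C := by
    intro C h1 h2 h3
    have := hthird C h3
    have := hthird A' hA'
    have := hthird B' hB'
    grind
  have hq : p ^ n.factorization p = 3 ∨ p ^ n.factorization p = 4 ∨ p ^ n.factorization p = 5 ∨
      p ^ n.factorization p = 7 := by
    by_contra hq
    apply hb
    rw [b, if_neg (by omega), if_neg (by omega), if_neg hq]
  have hr : n.factorization p ≠ 0 := by
    intro h0
    rw [h0, pow_zero] at h3
    omega
  have hprime : ∀ q : ℕ, q.Prime → p ^ n.factorization p = q → p = q ∧ n.factorization p = 1 := by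
    intro q hqp hq
    have hpq : p = q := (Nat.prime_dvd_prime_iff_eq hpp hqp).1 (hq ▸ dvd_pow_self p hr)
    subst hpq
    exact ⟨rfl, Nat.pow_right_injective hpp.two_le (hq.trans (pow_one p).symm)⟩
  have hodd : p = 3 ∨ p = 5 ∨ p = 7 → n.factorization p = 1 → False := by
    intro hp' h1
    rw [h1, pow_one] at hA' hB' hgcd hthird'
    obtain ⟨C, hC1, hC2, hC3⟩ := h.exists_third p hpp hp' h1 A' B' hAB' hA' hB' hgcd
    exact hthird' C hC1 hC2 hC3
  rcases hq with hq | hq | hq | hq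
  · obtain ⟨h1, h2⟩ := hprime 3 (by norm_num) hq
    exact (hodd (by omega) h2).elim
  · right
    obtain rfl : p = 2 := (Nat.prime_dvd_prime_iff_eq hpp Nat.prime_two).1
      (hpp.dvd_of_dvd_pow (n := 2) ((hq.trans (by norm_num : 4 = 2 ^ 2)) ▸ dvd_pow_self p hr))
    have h2 : n.factorization 2 = 2 := Nat.pow_right_injective (le_refl 2) hq
    rw [hq] at hA' hB' hgcd hthird'
    refine ⟨rfl, h2, by omega, ?_⟩
    rcases h.exists_third_four h2 A' B' hAB' hA' hB' hgcd with
      ⟨C, h1, h2, h3⟩ | ⟨C, D, hCD, h1, h2, h3, h4⟩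
    · exact (hthird' C h1 h2 h3).elim
    · exact ⟨C, D, hCD, ⟨h3, hthird' C h1.1 h1.2⟩, h4, hthird' D h2.1 h2.2⟩
  · obtain ⟨h1, h2⟩ := hprime 5 (by norm_num) hq
    exact (hodd (by omega) h2).elim
  · obtain ⟨h1, h2⟩ := hprime 7 (by norm_num) hq
    exact (hodd (by omega) h2).elim

/-- The prime powers other than 2 are paid by the orbit weights; an exact factor 2, or a deficit at
4, is paid by the slack of orbits of length 2 modulo 4. -/
lemma weightedSum_le (h : OrbitLengths n l) (hn : n ≠ 0) :
    weightedSum n ≤ ∑ O, l O + if n.factorization 3 = 1 ∧ n.factorization 2 = 2 then 1 else 0 := by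
  classical
  have hle := h.orbitWeight_le hn
  have hsplit : weightedSum n = ∑ p ∈ bigPrimes n, b (p ^ n.factorization p) * p ^ n.factorization p +
      if n.factorization 2 = 1 then 2 else 0 := by
    rw [weightedSum, bigPrimes, ← Finset.sum_filter_add_sum_filter_not n.primeFactors
      (fun p => p ^ n.factorization p ≠ 2)]
    congr 1
    have hq : ∀ p ∈ n.primeFactors, p ^ n.factorization p = 2 → p = 2 ∧ n.factorization 2 = 1 := by
      intro p hp hp2
      have hr : n.factorization p ≠ 0 := by
        rwa [← Finsupp.mem_support_iff, Nat.support_factorization]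
      obtain rfl : p = 2 := (Nat.prime_dvd_prime_iff_eq (Nat.prime_of_mem_primeFactors hp)
        Nat.prime_two).1 (hp2 ▸ dvd_pow_self p hr)
      exact ⟨rfl, Nat.pow_right_injective (le_refl 2) (hp2.trans (pow_one 2).symm)⟩
    split_ifs with h2
    · have : n.primeFactors.filter (fun p => ¬ p ^ n.factorization p ≠ 2) = {2} := by
        ext p
        rw [Finset.mem_filter, Finset.mem_singleton, not_not]
        constructor
        · exact fun hp => (hq p hp.1 hp.2).1
        · rintro rfl
          refine ⟨?_, by rw [h2, pow_one]⟩
          rw [← Nat.support_factorization, Finsupp.mem_support_iff]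
          omega
      rw [this, Finset.sum_singleton, h2]
      rfl
    · refine Finset.sum_eq_zero fun p hp => ?_
      rw [Finset.mem_filter, not_not] at hp
      exact absurd (hq p hp.1 hp.2).2 h2
  by_cases hall : ∀ p ∈ bigPrimes n, 2 * b (p ^ n.factorization p) ≤
      (Finset.univ.filter fun O => p ^ n.factorization p ∣ l O).card * orbitCoeff n l p
  · have hsum : 2 * ∑ p ∈ bigPrimes n, b (p ^ n.factorization p) * p ^ n.factorization p ≤
        ∑ O, orbitWeight n l O := by
      rw [sum_orbitWeight, Finset.mul_sum]
      refine Finset.sum_le_sum fun p hp => ?_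
      rw [← mul_assoc, ← mul_assoc]
      exact Nat.mul_le_mul_right _ (hall p hp)
    have hextra : ∑ O, orbitWeight n l O + (if n.factorization 2 = 1 then 4 else 0) ≤
        ∑ O, 2 * l O := by
      split_ifs with h2
      · have hn4 : ∀ O, ¬ 4 ∣ l O := by
          intro O hO
          have := (Nat.Prime.pow_dvd_iff_le_factorization (k := 2) Nat.prime_two hn).1
            (hO.trans (h.dvd O))
          omega
        have hn2 : 2 ∣ n := Nat.dvd_of_factorization_pos (by omega)
        obtain ⟨O, hO⟩ := h.exists_dvd 2 Nat.prime_two hn2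
        rw [h2, pow_one] at hO
        -- An exact factor 2 costs 2 points, hence slack 4. If the even orbit has length 6 and slack
        -- only 3, coefficient 3 at the prime 3 makes its companion `B` even as well, and the two
        -- together give 6.
        rcases h.orbitWeight_add_le hn hO (hn4 O) with h4 | ⟨h6, h3, hc, h3'⟩
        · exact sum_add_le_of_one _ _ hle h4
        · have h3O : 3 ^ n.factorization 3 ∣ l O := by
            rw [h6, h3]
            norm_num
          obtain ⟨B, hB, hBl⟩ := h.exists_ne 3 Nat.prime_three
            (Nat.dvd_of_factorization_pos (by omega)) (by rw [h3]; norm_num) O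
          have hgcd := gcd_ne_of_orbitCoeff_eq_three hc hB.symm h3O hBl
          have h2B : 2 ∣ l B := by
            by_contra hodd
            apply hgcd
            rw [h3, pow_one] at hBl ⊢
            rw [h6, show 6 = 2 * 3 by norm_num, Nat.Coprime.gcd_mul_left_cancel 3
              ((Nat.Prime.coprime_iff_not_dvd Nat.prime_two).2 hodd)]
            exact Nat.gcd_eq_left hBl
          have hB3 : orbitWeight n l B + 3 ≤ 2 * l B := by
            rcases h.orbitWeight_add_le hn h2B (hn4 B) with h' | h'
            · omega
            · exact h'.2.2.2
          have := sum_add_add_le_of_two _ _ hle hB.symm h3' hB3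
          omega
      · exact Finset.sum_le_sum fun O _ => hle O
    rw [← Finset.mul_sum] at hextra
    rw [hsplit]
    split_ifs at hextra ⊢ <;> omega
  · push Not at hall
    obtain ⟨p, hp, hlt⟩ := hall
    obtain ⟨rfl, h2, h8, C, D, hCD, hC, hD⟩ := (h.two_mul_b_le hp).resolve_left (by omega)
    -- At `q = 4` the requirement is 24 while two orbits with coefficient 2 contribute 16, so at
    -- most 8 is missing.
    have hsum : 2 * ∑ p ∈ bigPrimes n, b (p ^ n.factorization p) * p ^ n.factorization p ≤
        ∑ O, orbitWeight n l O + 8 := by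
      rw [sum_orbitWeight, Finset.mul_sum, ← Finset.add_sum_erase _ _ hp,
        ← Finset.add_sum_erase _ _ hp]
      have h1 : ∑ p ∈ (bigPrimes n).erase 2,
          2 * (b (p ^ n.factorization p) * p ^ n.factorization p) ≤
          ∑ p ∈ (bigPrimes n).erase 2,
            (Finset.univ.filter fun O => p ^ n.factorization p ∣ l O).card *
              (orbitCoeff n l p * p ^ n.factorization p) := by
        refine Finset.sum_le_sum fun p hp => ?_
        rw [← mul_assoc, ← mul_assoc]
        refine Nat.mul_le_mul_right _ ((h.two_mul_b_le (Finset.mem_of_mem_erase hp)).resolve_right ?_)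
        exact fun h' => Finset.ne_of_mem_erase hp h'.1
      have h3 : b (2 ^ n.factorization 2) * 2 ^ n.factorization 2 = 12 := by rw [h2]; rfl
      have h4 : 2 ^ n.factorization 2 = 4 := by rw [h2]; rfl
      rw [h3, ← mul_assoc]
      rw [h4] at h8 ⊢
      omega
    rw [hsplit, if_neg (show ¬ n.factorization 2 = 1 by omega)]
    have hC' := h.orbitWeight_add_le hn hC.1 hC.2
    have hD' := h.orbitWeight_add_le hn hD.1 hD.2
    by_cases h3 : n.factorization 3 = 1
    · rw [if_pos ⟨h3, h2⟩]
      -- Slack 6 against a deficit of 8: after halving, one point is lost.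
      have := sum_add_add_le_of_two _ _ hle hCD (x := 3) (y := 3) (by omega) (by omega)
      rw [← Finset.mul_sum] at this
      omega
    · rw [if_neg (by tauto)]
      have := sum_add_add_le_of_two _ _ hle hCD (x := 4) (y := 4) (by omega) (by omega)
      rw [← Finset.mul_sum] at this
      omega

end OrbitLengths

/-! ### Orbits of a generator of the automorphism group -/

section Orbits

variable {P : Type*} [PartialOrder P]

/-- On a finite set the inverse of a permutation is one of its powers, so preserving the order in
one direction is enough. -/
lemma exists_orderIso_of_strictMono [Finite P] {F : P → P} (hinj : Function.Injective F)
    (hF : ∀ x y, x < y → F x < F y) : ∃ f : P ≃o P, ∀ x, f x = F x := by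
  let σ : Equiv.Perm P := Equiv.ofBijective F ⟨hinj, Finite.surjective_of_injective hinj⟩
  have hmono : ∀ x y, x ≤ y → σ x ≤ σ y := by
    intro x y hxy
    rcases hxy.eq_or_lt with rfl | h
    · exact le_rfl
    · exact (hF x y h).le
  have hpow : ∀ (k : ℕ) x y, x ≤ y → (σ ^ k) x ≤ (σ ^ k) y := by
    intro k
    induction k with
    | zero => exact fun x y h => h
    | succ k ih =>
        intro x y h
        rw [pow_succ', Equiv.Perm.mul_apply, Equiv.Perm.mul_apply]
        exact hmono _ _ (ih x y h)
  refine ⟨⟨σ, fun {x y} => ⟨fun h => ?_, hmono x y⟩⟩, fun x => rfl⟩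
  have hinv : ∀ z, (σ ^ (orderOf σ - 1)) (σ z) = z := by
    intro z
    rw [← Equiv.Perm.mul_apply, ← pow_succ, Nat.sub_add_cancel (orderOf_pos σ), pow_orderOf_eq_one]
    rfl
  have := hpow (orderOf σ - 1) _ _ h
  rwa [hinv, hinv] at this

variable (g : P ≃o P)

lemma zpow_add_apply (i j : ℤ) (x : P) : (g ^ (i + j)) x = (g ^ i) ((g ^ j) x) := by
  rw [zpow_add]
  rfl

lemma zpow_apply_eq_self_iff (k : ℤ) (x : P) :
    (g ^ k) x = x ↔ (Function.minimalPeriod g x : ℤ) ∣ k :=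
  MulAction.zpow_smul_eq_iff_minimalPeriod_dvd (a := g) (b := x) (n := k)

lemma zpow_apply_eq_zpow_apply_iff (i j : ℤ) (x : P) :
    (g ^ i) x = (g ^ j) x ↔ (Function.minimalPeriod g x : ℤ) ∣ i - j := by
  rw [← zpow_apply_eq_self_iff, show i = j + (i - j) by ring, zpow_add_apply,
    EmbeddingLike.apply_eq_iff_eq, add_sub_cancel_left]

lemma minimalPeriod_zpow_apply (k : ℤ) (x : P) :
    Function.minimalPeriod g ((g ^ k) x) = Function.minimalPeriod g x := by
  have h : ∀ d : ℤ, (Function.minimalPeriod g ((g ^ k) x) : ℤ) ∣ d ↔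
      (Function.minimalPeriod g x : ℤ) ∣ d := by
    intro d
    rw [← zpow_apply_eq_self_iff, ← zpow_apply_eq_self_iff, ← zpow_add_apply, add_comm,
      zpow_add_apply, EmbeddingLike.apply_eq_iff_eq]
  exact Nat.dvd_antisymm (Int.natCast_dvd_natCast.1 ((h _).2 dvd_rfl))
    (Int.natCast_dvd_natCast.1 ((h _).1 dvd_rfl))

lemma minimalPeriod_dvd_orderOf (x : P) : Function.minimalPeriod g x ∣ orderOf g := by
  rw [← Int.natCast_dvd_natCast, ← zpow_apply_eq_self_iff, zpow_natCast, pow_orderOf_eq_one]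
  rfl

lemma zpow_lt_zpow_iff (k i j : ℤ) (x y : P) :
    (g ^ (k + i)) x < (g ^ (k + j)) y ↔ (g ^ i) x < (g ^ j) y := by
  rw [zpow_add_apply, zpow_add_apply, OrderIso.lt_iff_lt]

/-- Iterating the inequality over the order of `g` would give `x < x`; thus orbits are antichains.
-/
lemma not_lt_zpow_apply [Finite P] (k : ℤ) (x : P) : ¬ x < (g ^ k) x := by
  intro h
  have hlt : ∀ m : ℕ, x < (g ^ (k * (m + 1))) x := by
    intro m
    induction m with
    | zero => simpa using h
    | succ m ih =>
      push_cast
      rw [mul_add, mul_one, zpow_add_apply]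
      refine ih.trans ?_
      exact (OrderIso.lt_iff_lt _).2 h
  have : Finite (P ≃o P) := DFunLike.finite _
  have hpos := orderOf_pos g
  have := hlt (orderOf g - 1)
  rw [mul_comm, zpow_mul, show ((orderOf g - 1 : ℕ) : ℤ) + 1 = (orderOf g : ℕ) by omega,
    zpow_natCast, pow_orderOf_eq_one, one_zpow] at this
  exact lt_irrefl _ this

lemma not_zpow_lt_zpow [Finite P] (i j : ℤ) (x : P) : ¬ (g ^ i) x < (g ^ j) x := by
  have := not_lt_zpow_apply g (j - i) ((g ^ i) x)
  rwa [← zpow_add_apply, sub_add_cancel] at this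

/-- Used for periods: a point whose period misses the full power of `p` is fixed by `g ^ (n / p)`,
where `n` is the order of `g`. -/
lemma dvd_div_prime_of_not_dvd {n d p : ℕ} (hp : p.Prime) (hd : d ∣ n) (hn : n ≠ 0)
    (h : ¬ p ^ n.factorization p ∣ d) : d ∣ n / p := by
  obtain ⟨e, rfl⟩ := hd
  have hpe : p ∣ e := by
    by_contra hpe
    apply h
    have h1 : p ^ (d * e).factorization p ∣ d * e := Nat.ordProj_dvd _ _
    exact (Nat.Coprime.pow_left _ ((Nat.Prime.coprime_iff_not_dvd hp).2 hpe)).dvd_of_dvd_mul_right h1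
  obtain ⟨e', rfl⟩ := hpe
  rw [show d * (p * e') = p * (d * e') by ring, Nat.mul_div_cancel_left _ hp.pos]
  exact dvd_mul_right _ _

lemma exists_dvd_minimalPeriod [Finite P] {p : ℕ} (hp : p.Prime) (hpn : p ∣ orderOf g) :
    ∃ x, p ^ (orderOf g).factorization p ∣ Function.minimalPeriod g x := by
  by_contra! hcon
  have : Finite (P ≃o P) := DFunLike.finite _
  have hpos := orderOf_pos g
  have h1 : g ^ (orderOf g / p) = 1 := by
    ext x
    rw [← zpow_natCast]
    refine (zpow_apply_eq_self_iff g _ x).2 (Int.natCast_dvd_natCast.2 ?_)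
    exact dvd_div_prime_of_not_dvd hp (minimalPeriod_dvd_orderOf g x) hpos.ne' (hcon x)
  have h2 := Nat.le_of_dvd (Nat.div_pos (Nat.le_of_dvd hpos hpn) hp.pos)
    (orderOf_dvd_of_pow_eq_one h1)
  exact absurd h2 (not_le.2 (Nat.div_lt_self hpos hp.one_lt))

variable {g}

lemma commute_apply (hg : ∀ f : P ≃o P, f ∈ Subgroup.zpowers g) (f : P ≃o P) (k : ℤ) (x : P) :
    f ((g ^ k) x) = (g ^ k) (f x) := by
  obtain ⟨m, rfl⟩ := hg f
  change (g ^ m) ((g ^ k) x) = (g ^ k) ((g ^ m) x)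
  rw [← zpow_add_apply, add_comm, zpow_add_apply]

/-- Were the orbit of `x` the only one, `g ^ (n / p)`, with `n` the order of `g`, would fix every
point outside it. Then `x` and its image under this power have the same relations to all points, so
exchanging them is an automorphism, yet it does not commute with `g`. -/
lemma exists_other_orbit [Finite P] (hg : ∀ f : P ≃o P, f ∈ Subgroup.zpowers g) {p : ℕ}
    (hp : p.Prime) (hpn : p ∣ orderOf g) (h2 : p ^ (orderOf g).factorization p ≠ 2) (x : P) :
    ∃ y, (∀ k : ℤ, (g ^ k) x ≠ y) ∧
      p ^ (orderOf g).factorization p ∣ Function.minimalPeriod g y := by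
  classical
  have : Finite (P ≃o P) := DFunLike.finite _
  have hpos := orderOf_pos g
  set q := p ^ (orderOf g).factorization p with hq
  by_cases hx : q ∣ Function.minimalPeriod g x
  swap
  · obtain ⟨y, hy⟩ := exists_dvd_minimalPeriod g hp hpn
    refine ⟨y, ?_, hy⟩
    rintro k rfl
    rw [minimalPeriod_zpow_apply] at hy
    exact hx hy
  by_contra! hcon
  have hr : (orderOf g).factorization p ≠ 0 := (hp.factorization_pos_of_dvd hpos.ne' hpn).ne'
  have hq3 : 3 ≤ q := by
    have := hp.two_le.trans (Nat.le_self_pow hr p)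
    omega
  set a : ℤ := ((orderOf g / p : ℕ) : ℤ) with ha
  have hax : (g ^ a) x ≠ x := by
    rw [Ne, zpow_apply_eq_self_iff, ha, Int.natCast_dvd_natCast]
    intro hdvd
    have h1 : q * p ∣ orderOf g := by
      rw [← Nat.div_mul_cancel hpn]
      exact mul_dvd_mul (hx.trans hdvd) dvd_rfl
    rw [hq, ← pow_succ] at h1
    exact absurd ((hp.pow_dvd_iff_le_factorization hpos.ne').1 h1) (by omega)
  have hfix : ∀ y, (∀ k : ℤ, (g ^ k) x ≠ y) → (g ^ a) y = y := by
    intro y hy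
    rw [zpow_apply_eq_self_iff, ha, Int.natCast_dvd_natCast]
    exact dvd_div_prime_of_not_dvd hp (minimalPeriod_dvd_orderOf g y) hpos.ne' (hcon y hy)
  obtain ⟨f, hf⟩ := exists_orderIso_of_strictMono (Equiv.swap x ((g ^ a) x)).injective (by
    intro y z hyz
    have hout : ∀ w, (∀ k : ℤ, (g ^ k) x ≠ w) → Equiv.swap x ((g ^ a) x) w = w := by
      intro w hw
      exact Equiv.swap_apply_of_ne_of_ne (fun h => hw 0 h.symm) (fun h => hw a h.symm)
    have horb : ∀ w, ¬ (∀ k : ℤ, (g ^ k) x ≠ w) → ∀ v, (∀ k : ℤ, (g ^ k) x ≠ v) →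
        (w < v → Equiv.swap x ((g ^ a) x) w < v) ∧ (v < w → v < Equiv.swap x ((g ^ a) x) w) := by
      intro w hw v hv
      have hva := hfix v hv
      by_cases h1 : w = x
      · rw [h1, Equiv.swap_apply_left]
        refine ⟨fun h => ?_, fun h => ?_⟩
        · rwa [← hva, OrderIso.lt_iff_lt]
        · rwa [← hva, OrderIso.lt_iff_lt]
      · by_cases h2 : w = (g ^ a) x
        · rw [h2, Equiv.swap_apply_right]
          refine ⟨fun h => ?_, fun h => ?_⟩
          · rwa [← hva, OrderIso.lt_iff_lt] at h
          · rwa [← hva, OrderIso.lt_iff_lt] at h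
        · rw [Equiv.swap_apply_of_ne_of_ne h1 h2]
          exact ⟨id, id⟩
    by_cases hy : ∀ k : ℤ, (g ^ k) x ≠ y
    · rw [hout y hy]
      by_cases hz : ∀ k : ℤ, (g ^ k) x ≠ z
      · rwa [hout z hz]
      · exact (horb z hz y hy).2 hyz
    · by_cases hz : ∀ k : ℤ, (g ^ k) x ≠ z
      · rw [hout z hz]
        exact (horb y hy z hz).1 hyz
      · push Not at hy hz
        obtain ⟨i, rfl⟩ := hy
        obtain ⟨j, rfl⟩ := hz
        exact absurd hyz (not_zpow_lt_zpow g i j x))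
  have hcomm := commute_apply hg f 1 x
  rw [hf, hf, Equiv.swap_apply_left, ← zpow_add_apply] at hcomm
  have h1 : (g ^ (1 : ℤ)) x ≠ x := by
    rw [Ne, zpow_apply_eq_self_iff]
    intro h
    have := Int.le_of_dvd (by norm_num) ((Int.natCast_dvd_natCast.2 hx).trans h)
    omega
  -- Evaluated at `x`, commutation gives `g ^ 2` fixing `x` if `g x` is the swapped partner,
  -- impossible as `q ≥ 3`; otherwise `g ^ a` fixes `x`, against `hax`.
  by_cases h2 : (g ^ (1 : ℤ)) x = (g ^ a) x
  · rw [h2, Equiv.swap_apply_right, zpow_add_apply, ← h2, ← zpow_add_apply, eq_comm,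
      zpow_apply_eq_self_iff] at hcomm
    have := Int.le_of_dvd (by norm_num) ((Int.natCast_dvd_natCast.2 hx).trans hcomm)
    omega
  · rw [Equiv.swap_apply_of_ne_of_ne h1 h2, zpow_add_apply, EmbeddingLike.apply_eq_iff_eq] at hcomm
    exact hax hcomm.symm

end Orbits

/-! ### Twisting two orbits by permutations of residues -/

section Twist

variable {P : Type*} [PartialOrder P]

/-- For points in orbits whose lengths have greatest common divisor `q`, the order depends only on
exponents modulo `q`. -/
lemma exists_set_zmod (g : P ≃o P) (x y : P) {q : ℕ}
    (hq : (Function.minimalPeriod g x).gcd (Function.minimalPeriod g y) = q) :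
    ∃ S : Set (ZMod q), ∀ i j : ℤ, (g ^ i) x < (g ^ j) y ↔ (j - i : ZMod q) ∈ S := by
  have hper : ∀ k l : ℤ, (q : ℤ) ∣ l → (x < (g ^ (k + l)) y ↔ x < (g ^ k) y) := by
    rintro k _ ⟨m, rfl⟩
    -- By Bézout a multiple of `q` splits into an exponent fixing `x` and one fixing `y`.
    have hbez := Nat.gcd_eq_gcd_ab (Function.minimalPeriod g x) (Function.minimalPeriod g y)
    rw [hq] at hbez
    set s := (Function.minimalPeriod g x : ℤ) *
      (Function.minimalPeriod g x).gcdA (Function.minimalPeriod g y) * m with hs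
    set t := (Function.minimalPeriod g y : ℤ) *
      (Function.minimalPeriod g x).gcdB (Function.minimalPeriod g y) * m with ht
    have h1 : (g ^ s) x = x := by
      rw [zpow_apply_eq_self_iff, hs, mul_assoc]
      exact dvd_mul_right _ _
    have h2 : (g ^ t) y = y := by
      rw [zpow_apply_eq_self_iff, ht, mul_assoc]
      exact dvd_mul_right _ _
    have h3 : k + q * m = s + (k + t) := by
      rw [hbez, hs, ht]; ring
    rw [h3]
    conv_lhs => rw [← h1]
    rw [zpow_add_apply, OrderIso.lt_iff_lt, zpow_add_apply, h2]
  refine ⟨{s | ∃ k : ℤ, (k : ZMod q) = s ∧ x < (g ^ k) y}, fun i j => ?_⟩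
  have h0 : (g ^ i) x < (g ^ j) y ↔ x < (g ^ (j - i)) y := by
    have := zpow_lt_zpow_iff g i 0 (j - i) x y
    rwa [add_zero, add_sub_cancel, zpow_zero] at this
  rw [h0]
  constructor
  · exact fun h => ⟨j - i, by push_cast; rfl, h⟩
  · rintro ⟨k, hk, hlt⟩
    have : (q : ℤ) ∣ j - i - k := by
      rw [← ZMod.intCast_zmod_eq_zero_iff_dvd]
      push_cast
      rw [hk, sub_self]
    rw [← hper k (j - i - k) this, add_sub_cancel] at hlt
    exact hlt

variable [Finite P] {g : P ≃o P}

/-- If the relation between two orbits and their relations to all other points are preserved by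
twisting their residues modulo `q`, then the twists commute with the translation. -/
lemma twist_add_one (hg : ∀ f : P ≃o P, f ∈ Subgroup.zpowers g) {x y : P} {q : ℕ} [NeZero q]
    {e : ℤ} (he : (e : ZMod q) = 1) (hqx : q ∣ Function.minimalPeriod g x)
    (hqy : q ∣ Function.minimalPeriod g y) (S : Set (ZMod q))
    (hS : ∀ i j : ℤ, (g ^ i) x < (g ^ j) y ↔ (j - i : ZMod q) ∈ S)
    (hyx : ∀ i j : ℤ, ¬ (g ^ j) y < (g ^ i) x) (hxy : ∀ k : ℤ, (g ^ k) x ≠ y)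
    (uA uB : Equiv.Perm (ZMod q)) (hu : ∀ i j, j - i ∈ S → uB j - uA i ∈ S)
    (hA : ∀ (i : ℤ) z, (∀ k : ℤ, (g ^ k) x ≠ z) → (∀ k : ℤ, (g ^ k) y ≠ z) →
      ((g ^ i) x < z → (g ^ (e * (uA i - i).val)) ((g ^ i) x) < z) ∧
      (z < (g ^ i) x → z < (g ^ (e * (uA i - i).val)) ((g ^ i) x)))
    (hB : ∀ (i : ℤ) z, (∀ k : ℤ, (g ^ k) x ≠ z) → (∀ k : ℤ, (g ^ k) y ≠ z) →
      ((g ^ i) y < z → (g ^ (e * (uB i - i).val)) ((g ^ i) y) < z) ∧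
      (z < (g ^ i) y → z < (g ^ (e * (uB i - i).val)) ((g ^ i) y))) :
    (∀ i, uA (i + 1) = uA i + 1) ∧ ∀ i, uB (i + 1) = uB i + 1 := by
  classical
  have hφ : ∀ (w : Equiv.Perm (ZMod q)) (i : ℤ),
      ((e * (w i - i).val + i : ℤ) : ZMod q) = w i := by
    intro w i
    push_cast
    rw [he, ZMod.natCast_zmod_val]
    ring
  have hres : ∀ (z : P), q ∣ Function.minimalPeriod g z → ∀ i j : ℤ,
      (g ^ i) z = (g ^ j) z → (i : ZMod q) = j := by
    intro z hz i j h
    rw [zpow_apply_eq_zpow_apply_iff] at h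
    rw [← sub_eq_zero, ← Int.cast_sub, ZMod.intCast_zmod_eq_zero_iff_dvd]
    exact (Int.natCast_dvd_natCast.2 hz).trans h
  have hxy' : ∀ i j : ℤ, (g ^ i) x ≠ (g ^ j) y := by
    intro i j h
    apply hxy (-j + i)
    rw [zpow_add_apply, h, ← zpow_add_apply, neg_add_cancel]
    rfl
  -- The chosen exponents are determined only modulo the periods, but `q` divides these, so their
  -- residues are well defined. As `e` is 1 modulo `q`, the shift realises the permutation on
  -- residues.
  let F : P → P := fun z =>
    if h : ∃ i : ℤ, (g ^ i) x = z then (g ^ (e * (uA h.choose - h.choose).val)) z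
    else if h : ∃ i : ℤ, (g ^ i) y = z then (g ^ (e * (uB h.choose - h.choose).val)) z
    else z
  have hFx : ∀ i : ℤ, F ((g ^ i) x) = (g ^ (e * (uA i - i).val + i)) x := by
    intro i
    have h : ∃ j : ℤ, (g ^ j) x = (g ^ i) x := ⟨i, rfl⟩
    simp only [F, dif_pos h]
    rw [hres x hqx _ _ h.choose_spec, zpow_add_apply]
  have hFy : ∀ i : ℤ, F ((g ^ i) y) = (g ^ (e * (uB i - i).val + i)) y := by
    intro i
    have h : ∃ j : ℤ, (g ^ j) y = (g ^ i) y := ⟨i, rfl⟩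
    have h' : ¬ ∃ j : ℤ, (g ^ j) x = (g ^ i) y := fun ⟨j, hj⟩ => hxy' _ _ hj
    simp only [F, dif_neg h', dif_pos h]
    rw [hres y hqy _ _ h.choose_spec, zpow_add_apply]
  have hFz : ∀ z, (∀ k : ℤ, (g ^ k) x ≠ z) → (∀ k : ℤ, (g ^ k) y ≠ z) → F z = z := by
    intro z h h'
    simp only [F]
    rw [dif_neg (by simpa using h), dif_neg (by simpa using h')]
  have htri : ∀ z, (∃ i : ℤ, (g ^ i) x = z) ∨ (∃ i : ℤ, (g ^ i) y = z) ∨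
      ((∀ k : ℤ, (g ^ k) x ≠ z) ∧ ∀ k : ℤ, (g ^ k) y ≠ z) := by
    intro z
    by_cases h : ∃ i : ℤ, (g ^ i) x = z
    · exact Or.inl h
    by_cases h' : ∃ i : ℤ, (g ^ i) y = z
    · exact Or.inr (Or.inl h')
    exact Or.inr (Or.inr ⟨by simpa using h, by simpa using h'⟩)
  have hinjorb : ∀ (z : P) (w : Equiv.Perm (ZMod q)), q ∣ Function.minimalPeriod g z →
      ∀ i j : ℤ, (g ^ (e * (w i - i).val + i)) z = (g ^ (e * (w j - j).val + j)) z →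
      (g ^ i) z = (g ^ j) z := by
    intro z w hz i j h
    have h1 := hres z hz _ _ h
    rw [hφ, hφ, EmbeddingLike.apply_eq_iff_eq] at h1
    rw [h1] at h
    rw [zpow_apply_eq_zpow_apply_iff] at h ⊢
    rwa [add_sub_add_left_eq_sub] at h
  have hinj : Function.Injective F := by
    intro a c hac
    rcases htri a with ⟨i, rfl⟩ | ⟨i, rfl⟩ | ⟨ha1, ha2⟩ <;>
      rcases htri c with ⟨j, rfl⟩ | ⟨j, rfl⟩ | ⟨hc1, hc2⟩
    · rw [hFx, hFx] at hac
      exact hinjorb x uA hqx i j hac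
    · rw [hFx, hFy] at hac
      exact absurd hac (hxy' _ _)
    · rw [hFx, hFz c hc1 hc2] at hac
      exact absurd hac (hc1 _)
    · rw [hFx, hFy] at hac
      exact absurd hac.symm (hxy' _ _)
    · rw [hFy, hFy] at hac
      exact hinjorb y uB hqy i j hac
    · rw [hFy, hFz c hc1 hc2] at hac
      exact absurd hac (hc2 _)
    · rw [hFx, hFz a ha1 ha2] at hac
      exact absurd hac.symm (ha1 _)
    · rw [hFy, hFz a ha1 ha2] at hac
      exact absurd hac.symm (ha2 _)
    · rwa [hFz a ha1 ha2, hFz c hc1 hc2] at hac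
  obtain ⟨f, hf⟩ := exists_orderIso_of_strictMono hinj (by
    intro a c hac
    rcases htri a with ⟨i, rfl⟩ | ⟨i, rfl⟩ | ⟨ha1, ha2⟩ <;>
      rcases htri c with ⟨j, rfl⟩ | ⟨j, rfl⟩ | ⟨hc1, hc2⟩
    · exact absurd hac (not_zpow_lt_zpow g i j x)
    · rw [hFx, hFy, hS, hφ, hφ]
      exact hu _ _ ((hS i j).1 hac)
    · rw [hFx, hFz c hc1 hc2, zpow_add_apply]
      exact (hA i c hc1 hc2).1 hac
    · exact absurd hac (hyx _ _)
    · exact absurd hac (not_zpow_lt_zpow g i j y)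
    · rw [hFy, hFz c hc1 hc2, zpow_add_apply]
      exact (hB i c hc1 hc2).1 hac
    · rw [hFx, hFz a ha1 ha2, zpow_add_apply]
      exact (hA j a ha1 ha2).2 hac
    · rw [hFy, hFz a ha1 ha2, zpow_add_apply]
      exact (hB j a ha1 ha2).2 hac
    · rwa [hFz a ha1 ha2, hFz c hc1 hc2])
  have hend : ∀ (z : P) (w : Equiv.Perm (ZMod q)), q ∣ Function.minimalPeriod g z →
      (∀ i : ℤ, F ((g ^ i) z) = (g ^ (e * (w i - i).val + i)) z) → ∀ i, w (i + 1) = w i + 1 := by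
    intro z w hz hF i
    obtain ⟨i, rfl⟩ := ZMod.intCast_surjective i
    have h := commute_apply hg f 1 ((g ^ i) z)
    rw [← zpow_add_apply, hf, hf, hF, hF, ← zpow_add_apply] at h
    have h1 := hres z hz _ _ h
    rw [hφ, Int.cast_add 1 i, Int.cast_add 1, hφ, Int.cast_one] at h1
    rw [add_comm (i : ZMod q), h1, add_comm]
  exact ⟨hend x uA hqx hFx, hend y uB hqy hFy⟩

end Twist

/-! ### Forcing further orbits -/

section ThirdOrbit

/-- The power `g ^ e` advances residues modulo `q` by one and fixes every point whose period divides
`m`. -/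
lemma exists_zmod_eq_one_and_dvd {q m : ℕ} (h : q.Coprime m) :
    ∃ e : ℤ, (e : ZMod q) = 1 ∧ (m : ℤ) ∣ e := by
  obtain ⟨k, hk1, hk2⟩ := Nat.chineseRemainder h 1 0
  refine ⟨k, ?_, Int.natCast_dvd_natCast.2 ((Nat.modEq_zero_iff_dvd).1 hk2)⟩
  have := (ZMod.natCast_eq_natCast_iff _ _ _).2 hk1
  simpa using this

/-- An affine symmetry of `S` that is not a translation; `v` only witnesses that `u` is invertible.
-/
def ExistsMultiplier (p : ℕ) : Prop :=
  ∀ S : Finset (ZMod p), ∃ u v d : ZMod p, u * v = 1 ∧ u ≠ 1 ∧ ∀ s ∈ S, u * s + d ∈ S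

lemma existsMultiplier_of_small {p : ℕ} (h : p = 3 ∨ p = 5 ∨ p = 7) : ExistsMultiplier p := by
  unfold ExistsMultiplier
  rcases h with rfl | rfl | rfl
  · decide +kernel
  · decide +kernel
  · decide +kernel

/-- The alternatives for a circulant relation between two orbits of length divisible by 4. -/
lemma zmod_four_cases (S : Finset (ZMod 4)) :
    (∃ s, S = {s, s + 1}) ∨
    ∃ w : ZMod 4 → ZMod 4, (∀ j, w (w j) = j) ∧ (∀ j, (w j - j).val = 0 ∨ (w j - j).val = 2) ∧
      ∀ i j, j - i ∈ S → w j - Equiv.swap 0 2 i ∈ S := by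
  -- All three candidates move residues by 0 or 2 only, which points of period not divisible by 4
  -- cannot detect.
  have key : ∀ S : Finset (ZMod 4), (∃ s, S = {s, s + 1}) ∨ ∃ k : Fin 3,
      ∀ i j, j - i ∈ S → (![1, Equiv.swap 0 2, Equiv.swap 1 3] : Fin 3 → Equiv.Perm (ZMod 4)) k j -
        Equiv.swap 0 2 i ∈ S := by
    decide +kernel
  rcases key S with h | ⟨k, hk⟩
  · exact Or.inl h
  · refine Or.inr ⟨_, ?_, ?_, hk⟩
    · clear hk
      revert k
      decide
    · clear hk
      revert k
      decide

variable {P : Type*} [PartialOrder P] {g : P ≃o P}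

lemma zpow_ne_symm {x y : P} (hxy : ∀ k : ℤ, (g ^ k) x ≠ y) (k : ℤ) : (g ^ k) y ≠ x := by
  rintro rfl
  apply hxy (-k)
  rw [← zpow_add_apply, neg_add_cancel]
  rfl

variable [Finite P]

lemma not_lt_of_lt {x y : P} {i j : ℤ} (h : (g ^ i) x < (g ^ j) y) (k l : ℤ) :
    ¬ (g ^ k) y < (g ^ l) x := by
  intro h'
  have h1 := (zpow_lt_zpow_iff g (j - k) k l y x).2 h'
  rw [sub_add_cancel] at h1
  exact not_zpow_lt_zpow g _ _ x (h.trans h1)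

/-- Without a third orbit all remaining points are fixed by `g ^ e`, so multiplying residues by `u`
on one orbit and applying the affine map on the other is an automorphism; commuting with `g` forces
`u = 1`. -/
lemma exists_third_orbit_of_not_lt (hg : ∀ f : P ≃o P, f ∈ Subgroup.zpowers g) {p : ℕ}
    (hp : p.Prime) (hmul : ExistsMultiplier p) (h1 : (orderOf g).factorization p = 1) {x y : P}
    (hxy : ∀ k : ℤ, (g ^ k) x ≠ y) (hx : p ∣ Function.minimalPeriod g x)
    (hy : p ∣ Function.minimalPeriod g y)
    (hgcd : (Function.minimalPeriod g x).gcd (Function.minimalPeriod g y) = p)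
    (hyx : ∀ i j : ℤ, ¬ (g ^ j) y < (g ^ i) x) :
    ∃ z, (∀ k : ℤ, (g ^ k) x ≠ z) ∧ (∀ k : ℤ, (g ^ k) y ≠ z) ∧
      p ∣ Function.minimalPeriod g z := by
  classical
  by_contra! hcon
  have : Finite (P ≃o P) := DFunLike.finite _
  have : NeZero p := ⟨hp.ne_zero⟩
  have hpos := orderOf_pos g
  have hcop : p.Coprime (orderOf g / p) := by
    have := Nat.coprime_ordCompl hp hpos.ne'
    rwa [h1, pow_one] at this
  obtain ⟨e, he, hme⟩ := exists_zmod_eq_one_and_dvd hcop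
  obtain ⟨S, hS⟩ := exists_set_zmod g x y hgcd
  obtain ⟨u, v, d, huv, hu1, hu⟩ := hmul S.toFinite.toFinset
  simp only [Set.Finite.mem_toFinset] at hu
  let uA : Equiv.Perm (ZMod p) :=
    ⟨fun i => u * i, fun i => v * i, fun i => by linear_combination i * huv,
      fun i => by linear_combination i * huv⟩
  have hfix : ∀ z, (∀ k : ℤ, (g ^ k) x ≠ z) → (∀ k : ℤ, (g ^ k) y ≠ z) → ∀ k : ℤ,
      (g ^ (e * k)) z = z := by
    intro z hz hz' k
    rw [zpow_apply_eq_self_iff]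
    refine Dvd.dvd.mul_right (Dvd.dvd.trans (Int.natCast_dvd_natCast.2 ?_) hme) k
    refine dvd_div_prime_of_not_dvd hp (minimalPeriod_dvd_orderOf g z) hpos.ne' ?_
    rw [h1, pow_one]
    exact hcon z hz hz'
  have htw : ∀ (k : ℤ) (w z : P), (∀ k : ℤ, (g ^ k) x ≠ z) → (∀ k : ℤ, (g ^ k) y ≠ z) →
      (w < z → (g ^ (e * k)) w < z) ∧ (z < w → z < (g ^ (e * k)) w) := by
    intro k w z hz hz'
    have := hfix z hz hz' k
    refine ⟨fun h => ?_, fun h => ?_⟩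
    · rwa [← this, OrderIso.lt_iff_lt]
    · rwa [← this, OrderIso.lt_iff_lt]
  have := (twist_add_one hg he hx hy S hS hyx hxy uA (uA.trans (Equiv.addRight d)) (by
    intro i j hij
    have := hu _ hij
    convert this using 1
    change u * j + d - u * i = u * (j - i) + d
    ring) (fun i z hz hz' => htw _ _ z hz hz') (fun i z hz hz' => htw _ _ z hz hz')).1 0
  apply hu1
  simpa [uA] using this

lemma exists_third_orbit (hg : ∀ f : P ≃o P, f ∈ Subgroup.zpowers g) {p : ℕ}
    (hp : p.Prime) (hmul : ExistsMultiplier p) (h1 : (orderOf g).factorization p = 1) {x y : P}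
    (hxy : ∀ k : ℤ, (g ^ k) x ≠ y) (hx : p ∣ Function.minimalPeriod g x)
    (hy : p ∣ Function.minimalPeriod g y)
    (hgcd : (Function.minimalPeriod g x).gcd (Function.minimalPeriod g y) = p) :
    ∃ z, (∀ k : ℤ, (g ^ k) x ≠ z) ∧ (∀ k : ℤ, (g ^ k) y ≠ z) ∧
      p ∣ Function.minimalPeriod g z := by
  by_cases hlt : ∀ i j : ℤ, ¬ (g ^ j) y < (g ^ i) x
  · exact exists_third_orbit_of_not_lt hg hp hmul h1 hxy hx hy hgcd hlt
  · push Not at hlt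
    obtain ⟨i, j, hij⟩ := hlt
    obtain ⟨z, h1, h2, h3⟩ := exists_third_orbit_of_not_lt hg hp hmul h1 (zpow_ne_symm hxy) hy hx
      (by rwa [Nat.gcd_comm]) (fun k l => not_lt_of_lt hij l k)
    exact ⟨z, h2, h1, h3⟩

/-- If `x` and `y` lie in the only two orbits of length divisible by 4, and the lengths have greatest
common divisor 4, then there are two further orbits of even length. -/
lemma exists_third_orbit_four_of_not_lt (hg : ∀ f : P ≃o P, f ∈ Subgroup.zpowers g)
    (h1 : (orderOf g).factorization 2 = 2) {x y : P}
    (hxy : ∀ k : ℤ, (g ^ k) x ≠ y) (hx : 4 ∣ Function.minimalPeriod g x)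
    (hy : 4 ∣ Function.minimalPeriod g y)
    (hgcd : (Function.minimalPeriod g x).gcd (Function.minimalPeriod g y) = 4)
    (hyx : ∀ i j : ℤ, ¬ (g ^ j) y < (g ^ i) x)
    (hno : ∀ z, (∀ k : ℤ, (g ^ k) x ≠ z) → (∀ k : ℤ, (g ^ k) y ≠ z) →
      ¬ 4 ∣ Function.minimalPeriod g z) :
    ∃ z w, (∀ k : ℤ, (g ^ k) z ≠ w) ∧
      ((∀ k : ℤ, (g ^ k) x ≠ z) ∧ (∀ k : ℤ, (g ^ k) y ≠ z)) ∧
      ((∀ k : ℤ, (g ^ k) x ≠ w) ∧ (∀ k : ℤ, (g ^ k) y ≠ w)) ∧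
      2 ∣ Function.minimalPeriod g z ∧ 2 ∣ Function.minimalPeriod g w := by
  classical
  by_contra! hcon
  have : Finite (P ≃o P) := DFunLike.finite _
  have hpos := orderOf_pos g
  have hordn : 4 * (orderOf g / 4) = orderOf g :=
    Nat.mul_div_cancel' (hx.trans (minimalPeriod_dvd_orderOf g x))
  have hcop : Nat.Coprime 2 (orderOf g / 4) := by
    have := Nat.coprime_ordCompl Nat.prime_two hpos.ne'
    rwa [h1] at this
  obtain ⟨e, he, hme⟩ := exists_zmod_eq_one_and_dvd (hcop.pow_left 2)
  obtain ⟨S, hS⟩ := exists_set_zmod g x y hgcd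
  have hfix2 : ∀ z, (∀ k : ℤ, (g ^ k) x ≠ z) → (∀ k : ℤ, (g ^ k) y ≠ z) → ∀ k : ℤ,
      (g ^ (e * (2 * k))) z = z := by
    intro z hz hz' k
    rw [zpow_apply_eq_self_iff]
    have h2 : Function.minimalPeriod g z ∣ orderOf g / 2 := by
      refine dvd_div_prime_of_not_dvd Nat.prime_two (minimalPeriod_dvd_orderOf g z) hpos.ne' ?_
      rw [h1]
      exact hno z hz hz'
    rw [show orderOf g / 2 = (orderOf g / 4) * 2 by omega] at h2
    rw [← mul_assoc]
    refine Dvd.dvd.mul_right (Dvd.dvd.trans (Int.natCast_dvd_natCast.2 h2) ?_) k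
    push_cast
    exact mul_dvd_mul_right hme 2
  have hfix1 : ∀ z, ¬ 2 ∣ Function.minimalPeriod g z → ∀ k : ℤ, (g ^ (e * k)) z = z := by
    intro z hz k
    rw [zpow_apply_eq_self_iff]
    refine Dvd.dvd.mul_right (Dvd.dvd.trans (Int.natCast_dvd_natCast.2 ?_) hme) k
    have h2 := minimalPeriod_dvd_orderOf g z
    rw [← hordn] at h2
    exact (((Nat.Prime.coprime_iff_not_dvd Nat.prime_two).2 hz).symm.pow_right 2).dvd_of_dvd_mul_left
      h2
  have hmove : ∀ (k : ℤ) (z : P), (g ^ k) z = z → ∀ w,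
      (w < z → (g ^ k) w < z) ∧ (z < w → z < (g ^ k) w) := by
    intro k z hk w
    refine ⟨fun h => ?_, fun h => ?_⟩
    · rwa [← hk, OrderIso.lt_iff_lt]
    · rwa [← hk, OrderIso.lt_iff_lt]
  have hmove2 : ∀ (a : ZMod 4), (a.val = 0 ∨ a.val = 2) → ∀ z, (∀ k : ℤ, (g ^ k) x ≠ z) →
      (∀ k : ℤ, (g ^ k) y ≠ z) → ∀ w,
      (w < z → (g ^ (e * a.val)) w < z) ∧ (z < w → z < (g ^ (e * a.val)) w) := by
    intro a ha z hz hz' w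
    refine hmove _ z ?_ w
    rcases ha with ha | ha
    · rw [ha]; simp
    · rw [ha]; simpa using hfix2 z hz hz' 1
  rcases zmod_four_cases S.toFinite.toFinset with ⟨s, hs⟩ | ⟨w, hw1, hw2, hw3⟩
  swap
  · have := (twist_add_one hg he hx hy S hS hyx hxy (Equiv.swap 0 2) ⟨w, w, hw1, hw1⟩
      (by simpa using hw3) (fun i z hz hz' => hmove2 _ (by
        generalize (i : ZMod 4) = i
        revert i
        decide) z hz hz' _)
      (fun i z hz hz' => hmove2 _ (hw2 _) z hz hz' _)).1 0
    revert this
    decide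
  have hmem : ∀ t, t ∈ S ↔ t = s ∨ t = s + 1 := by
    intro t
    rw [← S.toFinite.mem_toFinset, hs, Finset.mem_insert, Finset.mem_singleton]
  have hres : ∀ i : ℤ, ((e * (2 * 1) + i : ℤ) : ZMod 4) = i + 2 := by
    intro i
    push_cast
    rw [show (e : ZMod 4) = 1 from he]
    ring
  have hd1 : ∀ s t : ZMod 4, (t = s ∨ t = s + 1) ∨ (t - 2 = s ∨ t - 2 = s + 1) := by decide
  have hd2 : ∀ s t : ZMod 4, (t = s ∨ t = s + 1) → ¬ (t + 2 = s ∨ t + 2 = s + 1) := by decide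
  -- The point `z` is insensitive to shifts of the orbit of `w` by multiples of `e`, odd ones
  -- included.
  let Ins : P → P → Prop := fun w z => ∀ i k : ℤ,
    ((g ^ i) w < z → (g ^ (e * k)) ((g ^ i) w) < z) ∧
    (z < (g ^ i) w → z < (g ^ (e * k)) ((g ^ i) w))
  have hshift : ∀ w z, (∀ k : ℤ, (g ^ k) x ≠ z) → (∀ k : ℤ, (g ^ k) y ≠ z) → ∀ i : ℤ,
      ((g ^ i) w < z → (g ^ (e * (2 * 1) + i)) w < z) ∧
      (z < (g ^ i) w → z < (g ^ (e * (2 * 1) + i)) w) := by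
    intro w z hz hz' i
    rw [zpow_add_apply]
    exact hmove _ z (hfix2 z hz hz' 1) _
  have hor : ∀ z, (∀ k : ℤ, (g ^ k) x ≠ z) → (∀ k : ℤ, (g ^ k) y ≠ z) → Ins x z ∨ Ins y z := by
    intro z hz hz'
    have hsh := fun w => hshift w z hz hz'
    -- If `z` is below a point of the `x`-orbit, it is also below that point's shift by 2; the upper
    -- bounds of these two cover the whole `y`-orbit. Dually, a `z` above a point of the `y`-orbit
    -- is above the whole `x`-orbit.
    by_cases hβ : ∃ i : ℤ, z < (g ^ i) x
    · obtain ⟨i, hi⟩ := hβ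
      right
      intro j k
      refine ⟨fun h => absurd (h.trans hi) (hyx _ _), fun _ => ?_⟩
      rw [← zpow_add_apply]
      generalize e * k + j = l
      rcases hd1 s (l - i) with h | h
      · exact hi.trans ((hS i l).2 ((hmem _).2 h))
      · refine ((hsh x i).2 hi).trans ((hS _ l).2 ((hmem _).2 ?_))
        rwa [hres, ← sub_sub]
    push Not at hβ
    by_cases hα : ∃ i : ℤ, (g ^ i) x < z
    swap
    · push Not at hα
      left
      exact fun i k => ⟨fun h => absurd h (hα i), fun h => absurd h (hβ i)⟩
    obtain ⟨i, hi⟩ := hα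
    by_cases hy' : ∃ j : ℤ, (g ^ j) y < z
    · obtain ⟨j, hj⟩ := hy'
      left
      intro m k
      refine ⟨fun _ => ?_, fun h => absurd h (hβ _)⟩
      rw [← zpow_add_apply]
      generalize e * k + m = l
      rcases hd1 s (j + 2 - l) with h | h
      · refine lt_trans ((hS l _).2 ((hmem _).2 ?_)) ((hsh y j).1 hj)
        rwa [hres]
      · refine lt_trans ((hS l j).2 ((hmem _).2 ?_)) hj
        convert h using 2 <;> ring
    · push Not at hy'
      right
      intro j k
      refine ⟨fun h => absurd h (hy' j), fun h => ?_⟩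
      -- A `z` between the two orbits would put a point of the `x`-orbit below both a point of the
      -- `y`-orbit and its shift by 2, but only one of the two residues lies in `S`.
      have h3 := (hmem _).1 ((hS i j).1 (hi.trans h))
      have h4 := (hmem _).1 ((hS i _).1 (hi.trans ((hsh y j).2 h)))
      rw [hres] at h4
      refine absurd ?_ (hd2 s _ h3)
      convert h4 using 2 <;> ring
  have hodd : ∀ w z, ¬ 2 ∣ Function.minimalPeriod g z → Ins w z := fun w z hz i k =>
    hmove _ z (hfix1 z hz k) _
  have htrans : ∀ w z, Ins w z → ∀ k : ℤ, Ins w ((g ^ k) z) := by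
    intro w z h k i m
    have h' := h (i - k) m
    rw [← zpow_add_apply] at h' ⊢
    have e1 := zpow_lt_zpow_iff g k (i - k) 0 w z
    have e2 := zpow_lt_zpow_iff g k (e * m + (i - k)) 0 w z
    have e3 := zpow_lt_zpow_iff g k 0 (i - k) z w
    have e4 := zpow_lt_zpow_iff g k 0 (e * m + (i - k)) z w
    rw [add_zero, add_sub_cancel, zpow_zero] at e1 e3
    rw [add_zero, show k + (e * m + (i - k)) = e * m + i by ring, zpow_zero] at e2 e4
    rw [e1, e2, e3, e4]
    exact h'
  have hall : (∀ z, (∀ k : ℤ, (g ^ k) x ≠ z) → (∀ k : ℤ, (g ^ k) y ≠ z) → Ins x z) ∨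
      ∀ z, (∀ k : ℤ, (g ^ k) x ≠ z) → (∀ k : ℤ, (g ^ k) y ≠ z) → Ins y z := by
    by_contra! hcon'
    obtain ⟨⟨z, hz, hz', hzi⟩, w, hw, hw', hwi⟩ := hcon'
    have hz2 : 2 ∣ Function.minimalPeriod g z := by
      by_contra h
      exact hzi (hodd x z h)
    have hw2 : 2 ∣ Function.minimalPeriod g w := by
      by_contra h
      exact hwi (hodd y w h)
    by_cases hzw : ∀ k : ℤ, (g ^ k) z ≠ w
    · exact hcon z w hzw ⟨hz, hz'⟩ ⟨hw, hw'⟩ hz2 hw2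
    · push Not at hzw
      obtain ⟨k, rfl⟩ := hzw
      exact hwi (htrans y z ((hor z hz hz').resolve_left hzi) k)
  -- Reflecting both orbits exchanges `s` and `s + 1`. For `d = 1` only the `x`-orbit moves by odd
  -- amounts, for `d = 0` only the `y`-orbit; `d` is chosen so that the odd moves fall on the orbit
  -- to which all other points are insensitive.
  have hrefl : ∀ d i j : ZMod 4, j - i ∈ S → d + (2 * s + 1) - j - (d - i) ∈ S := by
    intro d i j h
    rw [hmem] at h ⊢
    rcases h with h | h
    · right; linear_combination -h
    · left; linear_combination -h
  have hpar : ∀ s i : ZMod 4, (1 + (2 * s + 1) - i - i).val = 0 ∨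
      (1 + (2 * s + 1) - i - i).val = 2 := by decide
  rcases hall with h | h
  · have := (twist_add_one hg he hx hy S hS hyx hxy (Equiv.subLeft 1)
      (Equiv.subLeft (1 + (2 * s + 1))) (hrefl 1) (fun i z hz hz' => h z hz hz' i _)
      (fun i z hz hz' => hmove2 _ (by
        exact hpar s i) z hz hz' _)).1 0
    revert this
    decide
  · have := (twist_add_one hg he hx hy S hS hyx hxy (Equiv.subLeft 0)
      (Equiv.subLeft (0 + (2 * s + 1))) (hrefl 0) (fun i z hz hz' => hmove2 _ (by
        generalize (i : ZMod 4) = i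
        revert i
        decide) z hz hz' _) (fun i z hz hz' => h z hz hz' i _)).1 0
    revert this
    decide

lemma exists_third_orbit_four (hg : ∀ f : P ≃o P, f ∈ Subgroup.zpowers g)
    (h1 : (orderOf g).factorization 2 = 2) {x y : P}
    (hxy : ∀ k : ℤ, (g ^ k) x ≠ y) (hx : 4 ∣ Function.minimalPeriod g x)
    (hy : 4 ∣ Function.minimalPeriod g y)
    (hgcd : (Function.minimalPeriod g x).gcd (Function.minimalPeriod g y) = 4) :
    (∃ z, (∀ k : ℤ, (g ^ k) x ≠ z) ∧ (∀ k : ℤ, (g ^ k) y ≠ z) ∧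
      4 ∣ Function.minimalPeriod g z) ∨
    ∃ z w, (∀ k : ℤ, (g ^ k) z ≠ w) ∧
      ((∀ k : ℤ, (g ^ k) x ≠ z) ∧ (∀ k : ℤ, (g ^ k) y ≠ z)) ∧
      ((∀ k : ℤ, (g ^ k) x ≠ w) ∧ (∀ k : ℤ, (g ^ k) y ≠ w)) ∧
      2 ∣ Function.minimalPeriod g z ∧ 2 ∣ Function.minimalPeriod g w := by
  by_cases hno : ∃ z, (∀ k : ℤ, (g ^ k) x ≠ z) ∧ (∀ k : ℤ, (g ^ k) y ≠ z) ∧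
      4 ∣ Function.minimalPeriod g z
  · exact Or.inl hno
  push Not at hno
  right
  by_cases hlt : ∀ i j : ℤ, ¬ (g ^ j) y < (g ^ i) x
  · exact exists_third_orbit_four_of_not_lt hg h1 hxy hx hy hgcd hlt hno
  · push Not at hlt
    obtain ⟨i, j, hij⟩ := hlt
    obtain ⟨z, w, h1, h2, h3, h4⟩ := exists_third_orbit_four_of_not_lt hg h1 (zpow_ne_symm hxy)
      hy hx (by rwa [Nat.gcd_comm]) (fun k l => not_lt_of_lt hij l k)
      (fun z h h' => hno z h' h)
    exact ⟨z, w, h1, h2.symm, h3.symm, h4⟩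

end ThirdOrbit

/-! ### The lower bound and the theorem -/

section LowerBound

variable {P : Type u} [PartialOrder P] [Finite P]

lemma exists_orbitLengths {g : P ≃o P} (hg : ∀ f : P ≃o P, f ∈ Subgroup.zpowers g) :
    ∃ (Ω : Type u) (_ : Fintype Ω) (l : Ω → ℕ),
      OrbitLengths (orderOf g) l ∧ ∑ O, l O = Nat.card P := by
  classical
  let Ω := MulAction.orbitRel.Quotient (Subgroup.zpowers g) P
  have : Fintype P := Fintype.ofFinite P
  have : Finite Ω := Quotient.finite _
  have : Fintype Ω := Fintype.ofFinite Ω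
  let l : Ω → ℕ := fun O => Function.minimalPeriod g O.out
  have hrel : ∀ x y : P, (Quotient.mk _ x : Ω) = Quotient.mk _ y ↔ ∃ k : ℤ, (g ^ k) y = x := by
    intro x y
    rw [Quotient.eq, MulAction.orbitRel_apply, MulAction.mem_orbit_iff]
    constructor
    · rintro ⟨⟨_, k, rfl⟩, h⟩
      exact ⟨k, h⟩
    · rintro ⟨k, h⟩
      exact ⟨⟨g ^ k, k, rfl⟩, h⟩
  have hout : ∀ x : P, ∃ k : ℤ, (g ^ k) x = (Quotient.mk _ x : Ω).out := fun x =>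
    (hrel _ _).1 (Quotient.out_eq _)
  have hl : ∀ x : P, l (Quotient.mk _ x) = Function.minimalPeriod g x := by
    intro x
    obtain ⟨k, hk⟩ := hout x
    change Function.minimalPeriod g _ = _
    rw [← hk, minimalPeriod_zpow_apply]
  have hne : ∀ A B : Ω, A ≠ B → ∀ k : ℤ, (g ^ k) A.out ≠ B.out := by
    intro A B hAB k hk
    apply hAB
    rw [← Quotient.out_eq A, ← Quotient.out_eq B, eq_comm, hrel]
    exact ⟨k, hk⟩
  have hne' : ∀ (A : Ω) (y : P), (∀ k : ℤ, (g ^ k) A.out ≠ y) → (Quotient.mk _ y : Ω) ≠ A := by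
    rintro A y hy h
    rw [← Quotient.out_eq A, hrel] at h
    obtain ⟨k, hk⟩ := h
    exact hy k hk
  have hne2 : ∀ z w : P, (∀ k : ℤ, (g ^ k) z ≠ w) → (Quotient.mk _ z : Ω) ≠ Quotient.mk _ w := by
    intro z w h h'
    obtain ⟨k, hk⟩ := (hrel w z).1 h'.symm
    exact h k hk
  refine ⟨Ω, inferInstance, l, ⟨fun O => minimalPeriod_dvd_orderOf g _, ?_, ?_, ?_, ?_⟩, ?_⟩
  · intro p hp hpn
    obtain ⟨x, hx⟩ := exists_dvd_minimalPeriod g hp hpn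
    exact ⟨Quotient.mk _ x, by rwa [hl]⟩
  · intro p hp hpn h2 A
    obtain ⟨y, hy1, hy2⟩ := exists_other_orbit hg hp hpn h2 A.out
    exact ⟨Quotient.mk _ y, hne' A y hy1, by rwa [hl]⟩
  · intro p hp hp' h1 A B hAB hA hB hgcd
    obtain ⟨z, h2, h3, h4⟩ := exists_third_orbit hg hp (existsMultiplier_of_small hp') h1
      (hne A B hAB) hA hB hgcd
    exact ⟨Quotient.mk _ z, hne' A z h2, hne' B z h3, by rwa [hl]⟩
  · intro h1 A B hAB hA hB hgcd
    rcases exists_third_orbit_four hg h1 (hne A B hAB) hA hB hgcd with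
      ⟨z, h2, h3, h4⟩ | ⟨z, w, hzw, hz, hw, hz2, hw2⟩
    · exact Or.inl ⟨Quotient.mk _ z, hne' A z h2, hne' B z h3, by rwa [hl]⟩
    · exact Or.inr ⟨Quotient.mk _ z, Quotient.mk _ w, hne2 z w hzw,
        ⟨hne' A z hz.1, hne' B z hz.2⟩, ⟨hne' A w hw.1, hne' B w hw.2⟩, by rwa [hl], by rwa [hl]⟩
  · rw [Nat.card_congr (MulAction.selfEquivSigmaOrbits (Subgroup.zpowers g) P), Nat.card_sigma]
    refine Finset.sum_congr rfl fun O _ => ?_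
    rw [Nat.card_eq_fintype_card]
    exact MulAction.minimalPeriod_eq_card g O.out

lemma weightedSum_le_of_mem_posetSizes {n m : ℕ} (hn : n ≠ 0)
    (hm : m ∈ posetSizes.{u} (Multiplicative (ZMod n))) :
    weightedSum n ≤ m + if n.factorization 3 = 1 ∧ n.factorization 2 = 2 then 1 else 0 := by
  obtain ⟨P, _, _, rfl, ⟨e⟩⟩ := hm
  have : IsCyclic (P ≃o P) := isCyclic_of_surjective e.symm e.symm.surjective
  obtain ⟨g, hg⟩ := IsCyclic.exists_generator (α := P ≃o P)
  have hord : orderOf g = n := by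
    rw [orderOf_eq_card_of_forall_mem_zpowers hg, Nat.card_congr e.toEquiv,
      Nat.card_congr Multiplicative.toAdd, Nat.card_zmod]
  obtain ⟨Ω, _, l, hl, hsum⟩ := exists_orbitLengths hg
  rw [hord] at hl
  rw [← hsum]
  exact hl.weightedSum_le hn

end LowerBound

lemma exactlyDivides_iff {p r n : ℕ} (hp : p.Prime) (hn : n ≠ 0) :
    ExactlyDivides p r n ↔ n.factorization p = r := by
  rw [ExactlyDivides, hp.pow_dvd_iff_le_factorization hn, hp.pow_dvd_iff_le_factorization hn]
  omega

end CyclicPoset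

theorem mainTheorem1 (n : ℕ) (hn : 1 ≤ n) :
    (CyclicPoset.ExactlyDivides 3 1 n ∧ CyclicPoset.ExactlyDivides 2 2 n →
      IsLeast (CyclicPoset.posetSizes.{u} (Multiplicative (ZMod n)))
        (CyclicPoset.weightedSum n - 1)) ∧
    (¬ (CyclicPoset.ExactlyDivides 3 1 n ∧ CyclicPoset.ExactlyDivides 2 2 n) →
      IsLeast (CyclicPoset.posetSizes.{u} (Multiplicative (ZMod n)))
        (CyclicPoset.weightedSum n)) := by
  have hn0 : n ≠ 0 := by omega
  have hiff : CyclicPoset.ExactlyDivides 3 1 n ∧ CyclicPoset.ExactlyDivides 2 2 n ↔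
      n.factorization 3 = 1 ∧ n.factorization 2 = 2 := by
    rw [CyclicPoset.exactlyDivides_iff Nat.prime_three hn0,
      CyclicPoset.exactlyDivides_iff Nat.prime_two hn0]
  refine ⟨fun h => ⟨CyclicPoset.weightedSum_sub_one_mem_posetSizes n hn0 h.1 h.2, fun m hm => ?_⟩,
    fun h => ⟨CyclicPoset.weightedSum_mem_posetSizes n hn0, fun m hm => ?_⟩⟩
  · have := CyclicPoset.weightedSum_le_of_mem_posetSizes hn0 hm
    rw [if_pos (hiff.1 h)] at this
    omega
  · have := CyclicPoset.weightedSum_le_of_mem_posetSizes hn0 hm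
    rwa [if_neg (fun h' => h (hiff.2 h')), add_zero] at this
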